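/- \textbf{Setting.} Let $m\ge n$ and let $\mathbb{R}^{m\times n}$ carry the trace inner product $\langle X,Y\rangle=\mathrm{tr}(X^TY)$ and the Frobenius norm $\|\cdot\|$; $\sigma_1(X)\ge\dots\ge\sigma_n(X)\ge 0$ are the singular values of $X$. Let $f:\mathbb{R}^{m\times n}\to[0,\infty)$ be convex and Lipschitz with constant $L_f>0$, let $\lambda>0$ and $0<v<\lambda/L_f$, put $\Phi(X)=\sum_{i=1}^n\min\{1,\sigma_i(X)/v\}$, and assume that $f+\lambda\Phi$ has bounded sublevel sets. Let $\theta_1(t)=0$, $\theta_2(t)=t/v-1$, and for $d\in\{1,2\}^n$ let $\Phi^d(X)=\sum_{i=1}^n\bigl(\sigma_i(X)/v-\theta_{d_i}(\sigma_i(X))\bigr)$. Let $d^X\in\{1,2\}^n$ be given by $d^X_i=1$ if $\sigma_i(X)<v$ and $d^X_i=2$ if $\sigma_i(X)\ge v$. Let $\bar\mu,\kappa,\tilde L>0$ and let $\tilde f:\mathbb{R}^{m\times n}\times[0,\bar\mu]\to\mathbb{R}$ be a smoothing function of $f$: for each $\mu\in(0,\bar\mu]$, $\tilde f(\cdot,\mu)$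 is convex and continuously differentiable with $\tilde L\mu^{-1}$-Lipschitz gradient; $\tilde f(Z,\mu)\to f(X)$ as $Z\to X$, $\mu\downarrow0$; every limit of gradients $\nabla\tilde f(Z_i,\mu_i)$ with $Z_i\to X$, $\mu_i\downarrow 0$ lies in the Clarke subdifferential $\partial f(X)$; $|\tilde f(X,\mu_2)-\tilde f(X,\mu_1)|\le\kappa|\mu_1-\mu_2|$ for all $X$ and $\mu_1,\mu_2\in[0,\bar\mu]$, and $|\tilde f(X,\mu)-f(X)|\le\kappa\mu$ for all $X$ and $\mu\in(0,\bar\mu]$. \textbf{Algorithm (GIMSPG).} Let $\sigma\in(0,1)$, $\varepsilon>0$, $\alpha>0$, $\mu_{-1}=\mu_0\in(0,\bar\mu]$, $X^{-1}=X^0\in\mathbb{R}^{m\times n}$. For $k=0,1,2,\dots$ let $d^k=d^{X^k}$, $Y^k=X^k+\alpha_k(X^k-X^{k-1})$, $Z^k=X^k+\beta_k(X^k-X^{k-1})$, and let $X^{k+1}$ be any global minimizer over $X\in\mathbb{R}^{m\times n}$ of $$\langle X-Y^k,\nabla\tilde f(Z^k,\mu_k)\rangle+\tfrac12h_k\mu_k^{-1}\|X-Y^k\|^2+\lambda\Phi^{d^k}(X).$$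 With $$H_k:=\tilde f(X^k,\mu_{k-1})+\lambda\Phi(X^k)+\kappa\mu_{k-1}+\tfrac{h_k\alpha_k}{2}\mu_k^{-1}\|X^k-X^{k-1}\|^2,$$ one has $\mu_{k+1}=\mu_k$ if $H_{k+1}-H_k\le-\alpha\mu_k^2$, and $\mu_{k+1}=\mu_0/(k+1)^\sigma$ otherwise. The parameters satisfy, for all $k$: $(\alpha_k)$ is nonincreasing with $0\le\alpha_k<\frac{1-2^\sigma\varepsilon}{1+2^\sigma}$; $\beta_k\in[0,1]$; $h_k>0$ and $(h_k)$ is nonincreasing; and $$(1-\beta_k)\tilde L\le h_k\Bigl(1-\alpha_k-(\alpha_k+\varepsilon)\tfrac{\mu_k}{\mu_{k+1}}\Bigr),\qquad \beta_k\tilde L\le h_k\alpha_k.$$ \textbf{Theorem.} Let $\{X^k\}$, $\{\mu_k\}$ be infinite sequences generated in this way, and let $\mathcal{N}^s=\{k\in\mathbb{N}:\mu_{k+1}\ne\mu_k\}$. Then: (i) along the indices $k\in\mathcal{N}^s$ the vector $d^k$ changes only finitely many times, that is, there is $K$ such that $d^k=d^l$ for all $k,l\in\mathcal{N}^s$ with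 $k,l\ge K$; moreover, for all $k\in\mathcal{N}^s$ with $k\ge K$, every singular value of $X^k$ is either $0$ or at least $v$; (ii) any two accumulation points $\bar X$, $X^*$ of $\{X^k:k\in\mathcal{N}^s\}$ satisfy $\{i:\sigma_i(\bar X)=0\}=\{i:\sigma_i(X^*)=0\}$; moreover, whenever $\{X^{k_i}\}$ is a subsequence of $\{X^k:k\in\mathcal{N}^s\}$ with $X^{k_i}\to\bar X$, there is $J\in\mathbb{N}$ such that for all $i\ge J$, $\sigma_j(X^{k_i})=0$ for every $j$ with $\sigma_j(\bar X)=0$. -/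

import Mathlib

open Filter Topology Set

attribute [local instance] Matrix.frobeniusNormedAddCommGroup Matrix.frobeniusNormedSpace

namespace GIMSPG

noncomputable section

/-- The space of real `m × n` matrices; its norm `‖X‖` is the Frobenius norm. -/
abbrev Mat (m n : ℕ) : Type := Matrix (Fin m) (Fin n) ℝ

/-- The trace inner product `⟨X, Y⟩ = tr (Xᵀ Y)`. -/
def ip {m n : ℕ} (X Y : Mat m n) : ℝ := (X.transpose * Y).trace

/-- The singular values `σ₁(X) ≥ ⋯ ≥ σₙ(X) ≥ 0`, indexed from `0` to `n - 1`. -/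
def sv {m n : ℕ} (X : Mat m n) (i : Fin n) : ℝ :=
  (Matrix.toEuclideanLin X).singularValues i

/-- The capped `ℓ₁` function `φ(t) = min {1, t / v}`. -/
def phi (v t : ℝ) : ℝ := min 1 (t / v)

/-- The functions `θ₁(t) = 0` and `θ₂(t) = t / v - 1`, selected by the index `j ∈ {1, 2}`. -/
def theta (v : ℝ) (j : ℕ) (t : ℝ) : ℝ := if j = 1 then 0 else t / v - 1

/-- `Φ(X) = ∑ᵢ φ(σᵢ(X))`. -/
def Phi {m n : ℕ} (v : ℝ) (X : Mat m n) : ℝ := ∑ i, phi v (sv X i)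

/-- `Φᵈ(X) = ∑ᵢ (σᵢ(X) / v - θ_{dᵢ}(σᵢ(X)))` for `d ∈ {1, 2}ⁿ`. -/
def PhiD {m n : ℕ} (v : ℝ) (d : Fin n → ℕ) (X : Mat m n) : ℝ :=
  ∑ i, (sv X i / v - theta v (d i) (sv X i))

/-- The vector `d^X ∈ {1, 2}ⁿ`: `1` where `σᵢ(X) < v`, and `2` where `σᵢ(X) ≥ v`. -/
def dvec {m n : ℕ} (v : ℝ) (X : Mat m n) (i : Fin n) : ℕ :=
  if sv X i < v then 1 else 2

/-- The index set `{i | σᵢ(X) = 0}` of the zero singular values. -/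
def zeroSet {m n : ℕ} (X : Mat m n) : Set (Fin n) := {i | sv X i = 0}

/-- The gradient with respect to the trace inner product: the matrix of partial derivatives. -/
def grad {m n : ℕ} (F : Mat m n → ℝ) (X : Mat m n) : Mat m n :=
  Matrix.of fun i j => fderiv ℝ F X (Matrix.single i j 1)

/-- Clarke's generalized directional derivative
`f°(X; H) = limsup_{Y → X, t ↓ 0} (f (Y + t H) - f Y) / t` of a locally Lipschitz function. -/
def clarkeDeriv {m n : ℕ} (f : Mat m n → ℝ) (X H : Mat m n) : ℝ :=
  limsup (fun p : Mat m n × ℝ => (f (p.1 + p.2 • H) - f p.1) / p.2) (𝓝 X ×ˢ 𝓝[>] (0 : ℝ))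

/-- The Clarke subdifferential of a locally Lipschitz function. -/
def clarkeSubdiff {m n : ℕ} (f : Mat m n → ℝ) (X : Mat m n) : Set (Mat m n) :=
  {G | ∀ H, ip G H ≤ clarkeDeriv f X H}

/-- `ft X μ`, for `0 ≤ μ ≤ μbar`, is a smoothing function of `f`, with constant `κ` for the
dependence on `μ` and constant `Lt` for the Lipschitz moduli `Lt / μ` of the gradients. -/
structure IsSmoothing {m n : ℕ} (f : Mat m n → ℝ) (ft : Mat m n → ℝ → ℝ) (μbar κ Lt : ℝ) :
    Prop where
  μbar_pos : 0 < μbar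
  κ_pos : 0 < κ
  Lt_pos : 0 < Lt
  contDiff : ∀ μ ∈ Ioc 0 μbar, ContDiff ℝ 1 fun X => ft X μ
  tendsto : ∀ X, Tendsto (fun p : Mat m n × ℝ => ft p.1 p.2) (𝓝 X ×ˢ 𝓝[>] (0 : ℝ)) (𝓝 (f X))
  convex : ∀ μ ∈ Ioc 0 μbar, ConvexOn ℝ univ fun X => ft X μ
  grad_limit : ∀ (X G : Mat m n) (Z : ℕ → Mat m n) (ν : ℕ → ℝ),
    (∀ i, ν i ∈ Ioc 0 μbar) → Tendsto Z atTop (𝓝 X) → Tendsto ν atTop (𝓝 0) →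
    Tendsto (fun i => grad (fun Y => ft Y (ν i)) (Z i)) atTop (𝓝 G) → G ∈ clarkeSubdiff f X
  lipschitz_param : ∀ X, ∀ μ₁ ∈ Icc 0 μbar, ∀ μ₂ ∈ Icc 0 μbar,
    |ft X μ₂ - ft X μ₁| ≤ κ * |μ₁ - μ₂|
  approx : ∀ X, ∀ μ ∈ Ioc 0 μbar, |ft X μ - f X| ≤ κ * μ
  lipschitz_grad : ∀ μ ∈ Ioc 0 μbar, ∀ X Y,
    ‖grad (fun W => ft W μ) X - grad (fun W => ft W μ) Y‖ ≤ Lt * μ⁻¹ * ‖X - Y‖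

/-- The standing assumptions on `min f(X) + lam Φ(X)` over `m × n` matrices with `n ≤ m`:
`f ≥ 0` is convex and Lipschitz with constant `Lf`, `0 < v < lam / Lf`, and the objective has
bounded sublevel sets. -/
structure IsProblem {m n : ℕ} (f : Mat m n → ℝ) (lam v Lf : ℝ) : Prop where
  le : n ≤ m
  nonneg : ∀ X, 0 ≤ f X
  convex : ConvexOn ℝ univ f
  lam_pos : 0 < lam
  Lf_pos : 0 < Lf
  lipschitz : ∀ X Y, |f X - f Y| ≤ Lf * ‖X - Y‖
  v_pos : 0 < v
  v_lt : v < lam / Lf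
  levelBounded : ∀ c : ℝ, Bornology.IsBounded {X : Mat m n | f X + lam * Phi v X ≤ c}

/-- The parameter constraints on `a k = α_k`, `b k = β_k`, `h k`, for the smoothing parameters
`μ k` and the exponent `s ∈ (0, 1)`. The last two fields are the upper bound
`(h k)⁻¹ ≤ min {(1 - α_k - (α_k + ε) μ_k / μ_{k+1}) / ((1 - β_k) Lt), α_k / (β_k Lt)}`
cleared of denominators, so that they keep their meaning when `β_k` is `0` or `1`. -/
structure IsParam (s ε Lt : ℝ) (a b h μ : ℕ → ℝ) : Prop where
  ε_pos : 0 < ε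
  a_antitone : Antitone a
  a_nonneg : ∀ k, 0 ≤ a k
  a_lt : ∀ k, a k < (1 - 2 ^ s * ε) / (1 + 2 ^ s)
  b_mem : ∀ k, b k ∈ Icc (0 : ℝ) 1
  h_pos : ∀ k, 0 < h k
  h_antitone : Antitone h
  h_bound₁ : ∀ k, (1 - b k) * Lt ≤ h k * (1 - a k - (a k + ε) * (μ k / μ (k + 1)))
  h_bound₂ : ∀ k, b k * Lt ≤ h k * a k

/-- `X^k + c (X^k - X^{k-1})`. At `k = 0` the truncated subtraction `0 - 1 = 0` implements the
convention `X^{-1} = X^0`. -/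
def extrap {m n : ℕ} (X : ℕ → Mat m n) (c : ℝ) (k : ℕ) : Mat m n :=
  X k + c • (X k - X (k - 1))

/-- The subproblem objective
`Q_d(X, Y, Z, μ) = ⟨X - Y, ∇ft(Z, μ)⟩ + (h / (2 μ)) ‖X - Y‖² + lam Φᵈ(X)`. -/
def Q {m n : ℕ} (ft : Mat m n → ℝ → ℝ) (lam v h : ℝ) (d : Fin n → ℕ) (Y Z : Mat m n) (μ : ℝ)
    (X : Mat m n) : ℝ :=
  ip (X - Y) (grad (fun W => ft W μ) Z) + 1 / 2 * (h * μ⁻¹) * ‖X - Y‖ ^ 2 + lam * PhiD v d X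

/-- The auxiliary value `H_{δ_k}(X^k, X^{k-1}, μ_k, μ_{k-1}) =
ft(X^k, μ_{k-1}) + lam Φ(X^k) + κ μ_{k-1} + δ_k μ_k⁻¹ ‖X^k - X^{k-1}‖²` with
`δ_k = h_k α_k / 2`. At `k = 0` the truncated subtraction `0 - 1 = 0` implements the conventions
`X^{-1} = X^0` and `μ_{-1} = μ_0`. -/
def H {m n : ℕ} (ft : Mat m n → ℝ → ℝ) (lam v κ : ℝ) (a h μ : ℕ → ℝ) (X : ℕ → Mat m n)
    (k : ℕ) : ℝ :=
  (ft (X k) (μ (k - 1)) + lam * Phi v (X k)) + κ * μ (k - 1) +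
    h k * a k / 2 * (μ k)⁻¹ * ‖X k - X (k - 1)‖ ^ 2

/-- `X` and `μ` are sequences of iterates and of smoothing parameters produced by the general
inertial smoothing proximal gradient algorithm with data `a k = α_k`, `b k = β_k`, `h k`,
exponent `s`, and constant `α` in the descent test. -/
structure IsRun {m n : ℕ} (ft : Mat m n → ℝ → ℝ) (lam v μbar κ s α : ℝ) (a b h : ℕ → ℝ)
    (X : ℕ → Mat m n) (μ : ℕ → ℝ) : Prop where
  s_mem : s ∈ Ioo (0 : ℝ) 1
  α_pos : 0 < α
  μ_zero_mem : μ 0 ∈ Ioc 0 μbar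
  step : ∀ k, IsMinOn
    (Q ft lam v (h k) (dvec v (X k)) (extrap X (a k) k) (extrap X (b k) k) (μ k)) univ (X (k + 1))
  keep : ∀ k, H ft lam v κ a h μ X (k + 1) - H ft lam v κ a h μ X k ≤ -α * μ k ^ 2 →
    μ (k + 1) = μ k
  reduce : ∀ k, ¬ H ft lam v κ a h μ X (k + 1) - H ft lam v κ a h μ X k ≤ -α * μ k ^ 2 →
    μ (k + 1) = μ 0 / ((k : ℝ) + 1) ^ s

/-- The set `𝓝ˢ` of the indices at which the smoothing parameter changes. -/
def Ns (μ : ℕ → ℝ) : Set ℕ := {k | μ (k + 1) ≠ μ k}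

/-- `X (φ 0), X (φ 1), …` is a subsequence of `{X k : k ∈ N}` that converges to `Xbar`. -/
def SubseqTendsto {m n : ℕ} (X : ℕ → Mat m n) (N : Set ℕ) (φ : ℕ → ℕ) (Xbar : Mat m n) : Prop :=
  StrictMono φ ∧ (∀ i, φ i ∈ N) ∧ Tendsto (fun i => X (φ i)) atTop (𝓝 Xbar)

/-- `Xbar` is an accumulation point of `{X k : k ∈ N}`. -/
def IsAccPoint {m n : ℕ} (X : ℕ → Mat m n) (N : Set ℕ) (Xbar : Mat m n) : Prop :=
  ∃ φ, SubseqTendsto X N φ Xbar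

end

end GIMSPG

/-! Minimizing the subproblem soft-thresholds, by `lam / v * (μ k / h k)`, every singular value with
index `i` such that `σᵢ(X^k) < v`, applied to the extrapolated point minus a gradient step. The
gradient of the smoothed function is bounded by `Lf`, and `lam / v > Lf`. So a thresholded singular
value can survive only if inertia and the new increment together make up for a net loss proportional
to `μ k`.

The increments are small in two senses. The energy `H` decreases and is bounded below, which gives
`‖X^k - X^{k-1}‖² = o(μ k)` for all `k`. At an index of `Ns μ` the descent test fails, and then
`‖X^{k+1} - X^k‖` and `h k * a k * ‖X^k - X^{k-1}‖` are both `o(μ k)`. There the net loss wins: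
every singular value below `v` is zero one step later (`eventually_svN_succ_eq_zero`).

This must be propagated through the steps outside `Ns μ`, where only the weaker bound holds. Two
mechanisms do this, both with errors quadratic in the increment. By `Setup.dead_succ`, an inequality
on the squared tail of singular values persists and keeps the singular value below `v`. By
`exists_rank_le_extrapolation`, extrapolating two matrices of rank at most `r` stays within a
quadratic error of rank `r`, so the rank does not grow. With `r₀` the least index that ever becomes
dead, all late iterates have exactly `r₀` nonzero singular values, each at least `v`. The statements
on accumulation points follow because singular values are 1-Lipschitz (Mirsky). -/

namespace GIMSPG

open scoped InnerProductSpace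

/-! ### Trace inner product and Parseval identities. -/

section Inner

variable {m n : ℕ}

theorem ip_eq_sum (X Y : Mat m n) : ip X Y = ∑ j, ∑ i, X i j * Y i j := by
  simp [ip, Matrix.trace, Matrix.mul_apply]

theorem norm_sq_eq_ip (X : Mat m n) : ‖X‖ ^ 2 = ip X X := by
  rw [ip_eq_sum, Matrix.frobenius_norm_def, ← Real.sqrt_eq_rpow, Real.sq_sqrt (by positivity),
    Finset.sum_comm]
  refine Finset.sum_congr rfl fun j _ => Finset.sum_congr rfl fun i _ => ?_
  rw [Real.norm_eq_abs, Real.rpow_two, sq_abs, sq]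

/-- The inner product space structure on matrices given by the trace inner product; its norm is
the Frobenius norm. -/
@[reducible]
noncomputable def matInnerProductSpace : InnerProductSpace ℝ (Mat m n) where
  inner := ip
  norm_sq_eq_re_inner X := by simpa using norm_sq_eq_ip X
  conj_inner_symm X Y := by
    simp only [ip_eq_sum, conj_trivial]
    exact Finset.sum_congr rfl fun j _ => Finset.sum_congr rfl fun i _ => mul_comm _ _
  add_left X Y Z := by simp [ip_eq_sum, add_mul, Finset.sum_add_distrib]
  smul_left X Y c := by simp [ip_eq_sum, Finset.mul_sum, mul_assoc]

end Inner

attribute [local instance] matInnerProductSpace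

section Parseval

variable {m n : ℕ}

theorem inner_eq_ip (X Y : Mat m n) : ⟪X, Y⟫_ℝ = ip X Y := rfl

theorem inner_eq_sum_basis (v : OrthonormalBasis (Fin n) ℝ (EuclideanSpace ℝ (Fin n)))
    (X Y : Mat m n) :
    ⟪X, Y⟫_ℝ = ∑ i, ⟪Matrix.toEuclideanLin X (v i), Matrix.toEuclideanLin Y (v i)⟫_ℝ := by
  have h1 : ∀ i, ⟪Matrix.toEuclideanLin X (v i), Matrix.toEuclideanLin Y (v i)⟫_ℝ
      = ⟪v i, ((Matrix.toEuclideanLin X).adjoint ∘ₗ Matrix.toEuclideanLin Y) (v i)⟫_ℝ := by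
    intro i
    rw [LinearMap.comp_apply, LinearMap.adjoint_inner_right]
  simp_rw [h1]
  rw [← LinearMap.trace_eq_sum_inner,
    LinearMap.trace_eq_sum_inner _ (EuclideanSpace.basisFun (Fin n) ℝ), inner_eq_ip, ip_eq_sum]
  refine Finset.sum_congr rfl fun j _ => ?_
  rw [LinearMap.comp_apply, LinearMap.adjoint_inner_right]
  simp [PiLp.inner_apply, Matrix.toLpLin_apply, mul_comm]

theorem norm_sq_eq_sum_basis (v : OrthonormalBasis (Fin n) ℝ (EuclideanSpace ℝ (Fin n)))
    (X : Mat m n) : ‖X‖ ^ 2 = ∑ i, ‖Matrix.toEuclideanLin X (v i)‖ ^ 2 := by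
  rw [← real_inner_self_eq_norm_sq, inner_eq_sum_basis v]
  simp_rw [real_inner_self_eq_norm_sq]

theorem norm_toEuclideanLin_le (X : Mat m n) (y : EuclideanSpace ℝ (Fin n)) :
    ‖Matrix.toEuclideanLin X y‖ ≤ ‖X‖ * ‖y‖ := by
  have h := Matrix.frobenius_norm_mul X (Matrix.replicateCol Unit y.ofLp)
  rw [← Matrix.replicateCol_mulVec, Matrix.frobenius_norm_replicateCol,
    Matrix.frobenius_norm_replicateCol] at h
  exact h

end Parseval

/-! ### Rearrangement inequality for doubly substochastic weights. -/

section Rearrangement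

/-- Dual certificate for the rearrangement inequality with doubly substochastic weights. -/
theorem exists_dual_of_antitone {s w : ℕ → ℝ} (hs : Antitone s) (hw : Antitone w)
    (hs0 : ∀ i, 0 ≤ s i) (hw0 : ∀ i, 0 ≤ w i) (n : ℕ) :
    ∃ a b : ℕ → ℝ, (∀ i, i ≤ n → 0 ≤ a i) ∧ (∀ j, j ≤ n → 0 ≤ b j) ∧
      (∀ i, a i + b i = s i * w i) ∧ ∀ i j, s i * w j ≤ a i + b j := by
  -- `c` sums `w` against the drops of `s` (discrete Stieltjes integral); by monotonicity of `w`,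
  -- its increment from `i` to `j` lies between `w j` and `w i` times the total drop. The potential
  -- `a` is the part of this sum from `i` to `n`, plus `s n * w n`.
  set c : ℕ → ℝ := fun i => ∑ k ∈ Finset.range i, w k * (s k - s (k + 1)) with hc
  have hstep : ∀ k, c (k + 1) = c k + w k * (s k - s (k + 1)) := fun k =>
    Finset.sum_range_succ _ _
  have up : ∀ i j, i ≤ j → w j * (s i - s j) ≤ c j - c i := by
    intro i j hij
    induction j, hij using Nat.le_induction with
    | base => simp
    | succ j hij ih =>
      have h1 := hstep j
      have h2 := hw (Nat.le_succ j)
      have h3 := hs hij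
      have h4 := hs (Nat.le_succ j)
      simp only [Nat.succ_eq_add_one] at *
      nlinarith
  have lo : ∀ i j, i ≤ j → c j - c i ≤ w i * (s i - s j) := by
    intro i j hij
    induction j, hij using Nat.le_induction with
    | base => simp
    | succ j hij ih =>
      have h1 := hstep j
      have h2 := hw hij
      have h4 := hs (Nat.le_succ j)
      simp only [Nat.succ_eq_add_one] at *
      nlinarith
  refine ⟨fun i => c n - c i + s n * w n, fun i => s i * w i - (c n - c i + s n * w n),
    fun i hi => ?_, fun j hj => ?_, fun i => by ring, fun i j => ?_⟩
  · have := up i n hi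
    have h2 := mul_nonneg (hw0 n) (sub_nonneg.2 (hs hi))
    have h3 := mul_nonneg (hs0 n) (hw0 n)
    simp only
    linarith
  · have := lo j n hj
    have h3 := mul_nonneg (hs0 n) (sub_nonneg.2 (hw hj))
    simp only
    nlinarith
  · simp only
    rcases le_total i j with h | h
    · have := up i j h
      nlinarith
    · have := lo j i h
      nlinarith

theorem sum_mul_le_of_substochastic {s w : ℕ → ℝ} (hs : Antitone s) (hw : Antitone w)
    (hs0 : ∀ i, 0 ≤ s i) (hw0 : ∀ i, 0 ≤ w i) {n : ℕ} {P : Fin n → Fin n → ℝ}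
    (hP : ∀ i j, 0 ≤ P i j) (hrow : ∀ i, ∑ j, P i j ≤ 1) (hcol : ∀ j, ∑ i, P i j ≤ 1) :
    ∑ i, ∑ j, P i j * (s i * w j) ≤ ∑ i : Fin n, s i * w i := by
  obtain ⟨a, b, ha, hb, hab, hle⟩ := exists_dual_of_antitone hs hw hs0 hw0 n
  calc ∑ i, ∑ j, P i j * (s i * w j)
      ≤ ∑ i : Fin n, ∑ j : Fin n, (P i j * a i + P i j * b j) :=
        Finset.sum_le_sum fun i _ => Finset.sum_le_sum fun j _ => by
          rw [← mul_add]; exact mul_le_mul_of_nonneg_left (hle i j) (hP i j)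
    _ = ∑ i : Fin n, (∑ j, P i j) * a i + ∑ j : Fin n, (∑ i, P i j) * b j := by
        simp_rw [Finset.sum_add_distrib, Finset.sum_mul]
        rw [Finset.sum_comm (f := fun (i j : Fin n) => P i j * b j)]
    _ ≤ ∑ i : Fin n, a i + ∑ j : Fin n, b j := by
        gcongr with i _ j _
        · exact mul_le_of_le_one_left (ha i i.2.le) (hrow i)
        · exact mul_le_of_le_one_left (hb j j.2.le) (hcol j)
    _ = ∑ i : Fin n, s i * w i := by
        rw [← Finset.sum_add_distrib]
        exact Finset.sum_congr rfl fun i _ => hab i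

/-- Bessel's inequality, in a form that admits vectors shorter than one: left singular vectors of
zero singular values may vanish. -/
theorem sum_inner_sq_le_of_orthogonal {ι F : Type*} [Fintype ι] [NormedAddCommGroup F]
    [InnerProductSpace ℝ F] {u : ι → F} (horth : ∀ i j, i ≠ j → ⟪u i, u j⟫_ℝ = 0)
    (hu : ∀ i, ‖u i‖ ≤ 1) (x : F) : ∑ i, ⟪u i, x⟫_ℝ ^ 2 ≤ ‖x‖ ^ 2 := by
  have h0 : 0 ≤ ‖x - ∑ i, ⟪u i, x⟫_ℝ • u i‖ ^ 2 := by positivity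
  have h1 : ⟪x, ∑ i, ⟪u i, x⟫_ℝ • u i⟫_ℝ = ∑ i, ⟪u i, x⟫_ℝ ^ 2 := by
    rw [inner_sum]
    refine Finset.sum_congr rfl fun i _ => ?_
    rw [inner_smul_right, real_inner_comm, sq]
  have h2 : ‖∑ i, ⟪u i, x⟫_ℝ • u i‖ ^ 2 ≤ ∑ i, ⟪u i, x⟫_ℝ ^ 2 := by
    rw [← real_inner_self_eq_norm_sq, sum_inner]
    refine Finset.sum_le_sum fun i _ => ?_
    rw [inner_sum, Finset.sum_eq_single i]
    · rw [inner_smul_left, inner_smul_right, real_inner_self_eq_norm_sq]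
      have : ‖u i‖ ^ 2 ≤ 1 := pow_le_one₀ (norm_nonneg _) (hu i)
      simp only [conj_trivial]
      nlinarith [sq_nonneg ⟪u i, x⟫_ℝ]
    · intro j _ hj
      rw [inner_smul_left, inner_smul_right, horth i j hj.symm]
      simp
    · simp
  rw [norm_sub_sq_real, h1] at h0
  linarith

end Rearrangement

/-! ### Singular value decomposition, von Neumann and Mirsky inequalities. -/

section SVD

variable {m n : ℕ}

/-- The singular values as a sequence on `ℕ`, equal to zero from `n` on. -/
noncomputable def svN (X : Mat m n) : ℕ → ℝ := (Matrix.toEuclideanLin X).singularValues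

theorem sv_eq_svN (X : Mat m n) (i : Fin n) : sv X i = svN X i := rfl

theorem svN_nonneg (X : Mat m n) (i : ℕ) : 0 ≤ svN X i := LinearMap.singularValues_nonneg _ i

theorem svN_antitone (X : Mat m n) : Antitone (svN X) := LinearMap.singularValues_antitone _

theorem svN_of_le (X : Mat m n) {i : ℕ} (hi : n ≤ i) : svN X i = 0 :=
  LinearMap.singularValues_of_finrank_le _ (by simpa using hi)

theorem svN_eq_zero_iff (X : Mat m n) {r : ℕ} :
    svN X r = 0 ↔ Module.finrank ℝ (LinearMap.range (Matrix.toEuclideanLin X)) ≤ r :=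
  LinearMap.singularValues_eq_zero_iff_le_finrank_range _

/-- A singular value decomposition `X = ∑ᵢ sᵢ uᵢ vᵢᵀ`, where the left vectors `uᵢ` for `sᵢ = 0` may
be arbitrary vectors of norm at most one that keep the family orthogonal. -/
structure IsSVD (X : Mat m n) (s : ℕ → ℝ)
    (v : OrthonormalBasis (Fin n) ℝ (EuclideanSpace ℝ (Fin n)))
    (u : Fin n → EuclideanSpace ℝ (Fin m)) : Prop where
  antitone : Antitone s
  nonneg : ∀ i, 0 ≤ s i
  eq_zero : ∀ i, n ≤ i → s i = 0
  apply : ∀ i, Matrix.toEuclideanLin X (v i) = s i • u i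
  orthogonal : ∀ i j, i ≠ j → ⟪u i, u j⟫_ℝ = 0
  norm_le : ∀ i, ‖u i‖ ≤ 1
  norm_eq : ∀ i : Fin n, s i ≠ 0 → ‖u i‖ = 1

theorem exists_isSVD (X : Mat m n) : ∃ v u, IsSVD X (svN X) v u := by
  set T := Matrix.toEuclideanLin X with hT
  have hn : Module.finrank ℝ (EuclideanSpace ℝ (Fin n)) = n := by simp
  set v := T.isSymmetric_adjoint_comp_self.eigenvectorBasis hn with hv
  have hin : ∀ i j, ⟪T (v i), T (v j)⟫_ℝ = if i = j then svN X j ^ 2 else 0 := by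
    intro i j
    rw [← LinearMap.adjoint_inner_right, ← LinearMap.comp_apply, hv,
      LinearMap.IsSymmetric.apply_eigenvectorBasis, inner_smul_right,
      OrthonormalBasis.inner_eq_ite, ← LinearMap.sq_singularValues_fin]
    simp only [svN, ← hT]
    split_ifs <;> simp
  have hnorm : ∀ i, ‖T (v i)‖ = svN X i := by
    intro i
    have h := hin i i
    rw [if_pos rfl, real_inner_self_eq_norm_sq] at h
    exact (sq_eq_sq₀ (norm_nonneg _) (svN_nonneg X i)).1 h
  -- Since `0⁻¹ = 0`, the left vector of a zero singular value is the zero vector.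
  refine ⟨v, fun i => (svN X i)⁻¹ • T (v i), svN_antitone X, svN_nonneg X,
    fun i hi => svN_of_le X hi, fun i => ?_, fun i j hij => ?_, fun i => ?_, fun i hi => ?_⟩
  · by_cases h : svN X i = 0
    · have h2 := hnorm i
      rw [h, norm_eq_zero] at h2
      rw [h, zero_smul, h2]
    · rw [smul_inv_smul₀ h]
  · rw [inner_smul_left, inner_smul_right, hin, if_neg hij]
    simp
  · rw [norm_smul, hnorm, norm_inv, Real.norm_of_nonneg (svN_nonneg X i)]
    exact inv_mul_le_one
  · rw [norm_smul, hnorm, norm_inv, Real.norm_of_nonneg (svN_nonneg X i), inv_mul_cancel₀ hi]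

variable {X W : Mat m n} {s w : ℕ → ℝ}
  {v v' : OrthonormalBasis (Fin n) ℝ (EuclideanSpace ℝ (Fin n))}
  {u u' : Fin n → EuclideanSpace ℝ (Fin m)}

/-- Von Neumann's trace inequality. -/
theorem IsSVD.inner_le (h : IsSVD X s v u) (h' : IsSVD W w v' u') :
    ⟪X, W⟫_ℝ ≤ ∑ i : Fin n, s i * w i := by
  have e1 : ⟪X, W⟫_ℝ = ∑ i, ∑ j, (⟪v' j, v i⟫_ℝ * ⟪u i, u' j⟫_ℝ) * (s i * w j) := by
    rw [inner_eq_sum_basis v]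
    refine Finset.sum_congr rfl fun i _ => ?_
    conv_lhs => rw [h.apply, ← v'.sum_repr' (v i), map_sum, inner_sum]
    refine Finset.sum_congr rfl fun j _ => ?_
    rw [map_smul, h'.apply, inner_smul_left, inner_smul_right, inner_smul_right]
    simp only [conj_trivial]
    ring
  -- AM-GM bounds each product of overlaps by the mean of their squares, and Bessel bounds the row
  -- and column sums of these means by one.
  set P : Fin n → Fin n → ℝ := fun i j => (⟪v' j, v i⟫_ℝ ^ 2 + ⟪u i, u' j⟫_ℝ ^ 2) / 2 with hP
  rw [e1]
  refine le_trans (Finset.sum_le_sum fun i _ => Finset.sum_le_sum fun j _ =>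
    mul_le_mul_of_nonneg_right (?_ : _ ≤ P i j) (mul_nonneg (h.nonneg _) (h'.nonneg _))) ?_
  · simp only [hP]
    linarith [two_mul_le_add_sq ⟪v' j, v i⟫_ℝ ⟪u i, u' j⟫_ℝ]
  refine sum_mul_le_of_substochastic h.antitone h'.antitone h.nonneg h'.nonneg
    (fun i j => by positivity) (fun i => ?_) (fun j => ?_)
  · have h1 := sum_inner_sq_le_of_orthogonal (fun i j hij => v'.inner_eq_zero hij)
      (fun i => (v'.norm_eq_one i).le) (v i)
    have h2 := sum_inner_sq_le_of_orthogonal h'.orthogonal h'.norm_le (u i)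
    have h3 : ‖u i‖ ^ 2 ≤ 1 := pow_le_one₀ (norm_nonneg _) (h.norm_le i)
    rw [v.norm_eq_one] at h1
    simp only [hP]
    rw [← Finset.sum_div, Finset.sum_add_distrib]
    simp_rw [real_inner_comm (u' _) (u i)]
    simp_rw [real_inner_comm (u i) (u' _)] at *
    linarith
  · have h1 := sum_inner_sq_le_of_orthogonal (fun i j hij => v.inner_eq_zero hij)
      (fun i => (v.norm_eq_one i).le) (v' j)
    have h2 := sum_inner_sq_le_of_orthogonal h.orthogonal h.norm_le (u' j)
    have h3 : ‖u' j‖ ^ 2 ≤ 1 := pow_le_one₀ (norm_nonneg _) (h'.norm_le j)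
    rw [v'.norm_eq_one] at h1
    simp only [hP]
    rw [← Finset.sum_div, Finset.sum_add_distrib]
    simp_rw [real_inner_comm (v _) (v' j)]
    linarith

theorem IsSVD.norm_sq (h : IsSVD X s v u) : ‖X‖ ^ 2 = ∑ i : Fin n, s i ^ 2 := by
  rw [norm_sq_eq_sum_basis v]
  refine Finset.sum_congr rfl fun i _ => ?_
  rw [h.apply, norm_smul, Real.norm_of_nonneg (h.nonneg i), mul_pow]
  by_cases hi : s i = 0
  · simp [hi]
  · rw [h.norm_eq i hi, one_pow, mul_one]

theorem IsSVD.sum_sub_sq_le (h : IsSVD X s v u) (h' : IsSVD W w v' u') :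
    ∑ i : Fin n, (s i - w i) ^ 2 ≤ ‖X - W‖ ^ 2 := by
  have := h.inner_le h'
  rw [norm_sub_sq_real, h.norm_sq, h'.norm_sq]
  simp_rw [sub_sq, Finset.sum_add_distrib, Finset.sum_sub_distrib]
  have : ∑ i : Fin n, 2 * s i * w i = 2 * ∑ i : Fin n, s i * w i := by
    rw [Finset.mul_sum]; simp_rw [mul_assoc]
  linarith

/-- Comparing two decompositions of the same matrix in `sum_sub_sq_le` gives distance zero, hence
uniqueness of the singular values. -/
theorem IsSVD.eq_svN (h : IsSVD X s v u) : s = svN X := by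
  obtain ⟨v', u', h'⟩ := exists_isSVD X
  have h0 := h.sum_sub_sq_le h'
  rw [sub_self, norm_zero, zero_pow two_ne_zero] at h0
  have h1 := (Finset.sum_eq_zero_iff_of_nonneg (fun i _ => sq_nonneg _)).1
    (le_antisymm h0 (Finset.sum_nonneg fun i _ => sq_nonneg _))
  funext i
  by_cases hi : i < n
  · have := h1 ⟨i, hi⟩ (Finset.mem_univ _)
    exact sub_eq_zero.1 (pow_eq_zero_iff two_ne_zero |>.1 this)
  · rw [h.eq_zero i (not_lt.1 hi), svN_of_le X (not_lt.1 hi)]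

/-- Mirsky's inequality for the Frobenius norm. -/
theorem sum_svN_sub_sq_le (X W : Mat m n) :
    ∑ i : Fin n, (svN X i - svN W i) ^ 2 ≤ ‖X - W‖ ^ 2 := by
  obtain ⟨v, u, h⟩ := exists_isSVD X
  obtain ⟨v', u', h'⟩ := exists_isSVD W
  exact h.sum_sub_sq_le h'

theorem abs_svN_sub_le (X W : Mat m n) (i : ℕ) : |svN X i - svN W i| ≤ ‖X - W‖ := by
  by_cases hi : i < n
  · refine abs_le_of_sq_le_sq ?_ (norm_nonneg _)
    refine le_trans ?_ (sum_svN_sub_sq_le X W)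
    exact Finset.single_le_sum (f := fun i : Fin n => (svN X i - svN W i) ^ 2)
      (fun i _ => sq_nonneg _) (Finset.mem_univ ⟨i, hi⟩)
  · simp [svN_of_le _ (not_lt.1 hi)]

/-- Singular values can be lowered while keeping the singular vectors. -/
theorem exists_svN_eq (W : Mat m n) {s : ℕ → ℝ} (hs : Antitone s) (hs0 : ∀ i, 0 ≤ s i)
    (hsW : ∀ i, s i ≤ svN W i) :
    ∃ X : Mat m n, svN X = s ∧ ‖X - W‖ ^ 2 ≤ ∑ i : Fin n, (s i - svN W i) ^ 2 := by
  obtain ⟨v, u, h⟩ := exists_isSVD W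
  set X : Mat m n := Matrix.toEuclideanLin.symm (v.toBasis.constr ℝ fun i => s i • u i) with hX
  have hXv : ∀ i, Matrix.toEuclideanLin X (v i) = s i • u i := by
    intro i
    rw [hX, LinearEquiv.apply_symm_apply, ← v.coe_toBasis, Module.Basis.constr_basis]
  have hz : ∀ i, svN W i = 0 → s i = 0 := fun i hi => le_antisymm (hi ▸ hsW i) (hs0 i)
  have hsvd : IsSVD X s v u := ⟨hs, hs0, fun i hi => hz i (svN_of_le W hi), hXv, h.orthogonal,
    h.norm_le, fun i hi => h.norm_eq i fun h0 => hi (hz i h0)⟩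
  refine ⟨X, hsvd.eq_svN.symm, ?_⟩
  rw [norm_sq_eq_sum_basis v]
  refine Finset.sum_le_sum fun i _ => ?_
  rw [map_sub, LinearMap.sub_apply, hXv, h.apply, ← sub_smul, norm_smul, mul_pow,
    Real.norm_eq_abs, sq_abs]
  exact mul_le_of_le_one_right (sq_nonneg _) (pow_le_one₀ (norm_nonneg _) (h.norm_le i))

end SVD

/-! ### Tails of singular values, low-rank approximation, proximal steps. -/

section Tail

variable {m n : ℕ}

/-- The sum of the squares of all but the `r` largest singular values. -/
noncomputable def tailSq (r : ℕ) (X : Mat m n) : ℝ :=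
  ∑ i : Fin n, if r ≤ i then svN X i ^ 2 else 0

theorem tailSq_nonneg (r : ℕ) (X : Mat m n) : 0 ≤ tailSq r X :=
  Finset.sum_nonneg fun i _ => by split_ifs <;> positivity

theorem svN_sq_le_tailSq (r : ℕ) (X : Mat m n) : svN X r ^ 2 ≤ tailSq r X := by
  by_cases hr : r < n
  · have := Finset.single_le_sum (f := fun i : Fin n => if r ≤ i then svN X i ^ 2 else 0)
      (fun i _ => by split_ifs <;> positivity) (Finset.mem_univ ⟨r, hr⟩)
    simpa [tailSq] using this
  · rw [svN_of_le X (not_lt.1 hr)]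
    simpa using tailSq_nonneg r X

theorem tailSq_eq_zero {r : ℕ} {X : Mat m n} (h : svN X r = 0) : tailSq r X = 0 := by
  refine Finset.sum_eq_zero fun i _ => ?_
  split_ifs with hi
  · rw [le_antisymm ((svN_antitone X hi).trans h.le) (svN_nonneg X i)]
    simp
  · rfl

theorem tailSq_le_svN_sq {r : ℕ} {X : Mat m n} (h : svN X (r + 1) = 0) :
    tailSq r X ≤ svN X r ^ 2 := by
  by_cases hr : r < n
  · rw [tailSq, Finset.sum_eq_single (⟨r, hr⟩ : Fin n)]
    · simp
    · intro i _ hi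
      split_ifs with hri
      · have : r + 1 ≤ (i : ℕ) := by
          rcases hri.lt_or_eq with h | h
          · exact h
          · exact absurd (Fin.ext h.symm) hi
        rw [le_antisymm ((svN_antitone X this).trans h.le) (svN_nonneg X i)]
        simp
      · rfl
    · simp
  · rw [tailSq_eq_zero (svN_of_le X (not_lt.1 hr))]
    positivity

/-- The Eckart–Young inequality. -/
theorem tailSq_le_norm_sub_sq (r : ℕ) (X P : Mat m n) (hP : svN P r = 0) :
    tailSq r X ≤ ‖X - P‖ ^ 2 := by
  refine le_trans (Finset.sum_le_sum fun i _ => ?_) (sum_svN_sub_sq_le X P)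
  split_ifs with hi
  · rw [le_antisymm ((svN_antitone P hi).trans hP.le) (svN_nonneg P i), sub_zero]
  · positivity

theorem exists_norm_sub_sq_le_tailSq (r : ℕ) (X : Mat m n) :
    ∃ P : Mat m n, svN P r = 0 ∧ ‖X - P‖ ^ 2 ≤ tailSq r X := by
  obtain ⟨P, hP, hle⟩ := exists_svN_eq X (s := fun i => if r ≤ i then 0 else svN X i)
    (fun i j hij => by
      dsimp only
      split_ifs with h1 h2 h2
      · exact le_rfl
      · exact svN_nonneg X i
      · omega
      · exact svN_antitone X hij)
    (fun i => by split_ifs; exacts [le_rfl, svN_nonneg X i])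
    (fun i => by split_ifs; exacts [svN_nonneg X i, le_rfl])
  refine ⟨P, by rw [hP]; simp, ?_⟩
  rw [norm_sub_rev]
  refine hle.trans (Finset.sum_le_sum fun i _ => ?_)
  split_ifs <;> simp

/-- Soft thresholding lowers the `ℓ²` norm of the tail of the singular values by the threshold. -/
theorem sq_sqrt_tailSq_add_le {X W : Mat m n} {r : ℕ} {τ : ℝ} (hτ : 0 ≤ τ)
    (h : ∀ i, r ≤ i → svN X i = max (svN W i - τ) 0) (hr : svN X r ≠ 0) :
    (√(tailSq r X) + τ) ^ 2 ≤ tailSq r W := by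
  have hrn : r < n := by
    by_contra hn
    exact hr (svN_of_le X (not_lt.1 hn))
  set S := ∑ i : Fin n, if r ≤ i then svN X i else 0 with hS
  have hS0 : 0 ≤ S := Finset.sum_nonneg fun i _ => by
    split_ifs; exacts [svN_nonneg X i, le_rfl]
  have hqS : √(tailSq r X) ≤ S := by
    rw [Real.sqrt_le_left hS0]
    have h1 : tailSq r X = ∑ i : Fin n, (if r ≤ i then svN X i else 0) ^ 2 :=
      Finset.sum_congr rfl fun i _ => by split_ifs <;> simp
    rw [h1, hS]
    exact Finset.sum_sq_le_sq_sum_of_nonneg fun i _ => by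
      split_ifs; exacts [svN_nonneg X i, le_rfl]
  -- Each surviving value satisfies `svN W i = svN X i + τ`; its square is expanded, and the term `τ
  -- ^ 2` is kept only at index `r`, which is known to survive. Summation then needs only that the
  -- `ℓ¹` norm `S` dominates the `ℓ²` norm.
  have hpt : ∀ i : Fin n, ((if r ≤ i then svN X i ^ 2 else 0) + 2 * τ * (if r ≤ i then svN X i else 0)
      + if i = ⟨r, hrn⟩ then τ ^ 2 else 0) ≤ if r ≤ i then svN W i ^ 2 else 0 := by
    intro i
    by_cases hi : r ≤ i
    · simp only [hi, if_true]
      by_cases h0 : svN X i = 0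
      · have : i ≠ ⟨r, hrn⟩ := by
          rintro rfl
          exact hr h0
        rw [h0, if_neg this]
        nlinarith [sq_nonneg (svN W i)]
      · have h1 := h i hi
        have h2 : svN X i = svN W i - τ := by
          rcases max_choice (svN W i - τ) 0 with h3 | h3
          · rw [h1, h3]
          · exact absurd (h1.trans h3) h0
        have h3 : svN W i = svN X i + τ := by linarith
        rw [h3]
        have : (if i = (⟨r, hrn⟩ : Fin n) then τ ^ 2 else 0) ≤ τ ^ 2 := by
          split_ifs; exacts [le_rfl, sq_nonneg τ]
        nlinarith
    · have : i ≠ ⟨r, hrn⟩ := by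
        rintro rfl
        exact hi le_rfl
      simp [hi, this]
  have hsum := Finset.sum_le_sum fun i (_ : i ∈ Finset.univ) => hpt i
  simp only [Finset.sum_add_distrib, ← Finset.mul_sum, Finset.sum_ite_eq', Finset.mem_univ,
    if_true] at hsum
  change tailSq r X + 2 * τ * S + τ ^ 2 ≤ tailSq r W at hsum
  have := Real.sq_sqrt (tailSq_nonneg r X)
  nlinarith

/-- The singular values of a minimizer of a proximal problem with a weighted sum of singular
values, the weights being nondecreasing. -/
theorem svN_of_isMin_prox {X W : Mat m n} {t : ℕ → ℝ} (ht : Monotone t) (ht0 : ∀ i, 0 ≤ t i)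
    (hmin : ∀ X' : Mat m n, 1 / 2 * ‖X - W‖ ^ 2 + ∑ i : Fin n, t i * svN X i ≤
      1 / 2 * ‖X' - W‖ ^ 2 + ∑ i : Fin n, t i * svN X' i) (i : ℕ) :
    svN X i = max (svN W i - t i) 0 := by
  obtain ⟨X', hX', hle⟩ := exists_svN_eq W (s := fun i => max (svN W i - t i) 0)
    (fun i j hij => max_le_max (sub_le_sub (svN_antitone W hij) (ht hij)) le_rfl)
    (fun i => le_max_right _ _)
    (fun i => max_le (sub_le_self _ (ht0 i)) (svN_nonneg W i))
  by_cases hi : n ≤ i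
  · rw [svN_of_le X hi, svN_of_le W hi, max_eq_right]
    linarith [ht0 i]
  have h1 := hmin X'
  have h2 := sum_svN_sub_sq_le X W
  -- Quadratic growth of the scalar proximal objective around its minimizer. Mirsky bounds the
  -- matrix objective at `X` below by the sum of scalar ones, while `X'` attains their minimum, so
  -- all gaps vanish.
  have hpt : ∀ j : Fin n, 1 / 2 * (max (svN W j - t j) 0 - svN W j) ^ 2 +
      t j * max (svN W j - t j) 0 + 1 / 2 * (svN X j - max (svN W j - t j) 0) ^ 2 ≤
      1 / 2 * (svN X j - svN W j) ^ 2 + t j * svN X j := by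
    intro j
    have hx := svN_nonneg X j
    rcases le_total (svN W j - t j) 0 with h | h
    · rw [max_eq_right h]
      nlinarith
    · rw [max_eq_left h]
      nlinarith
  have hsum := Finset.sum_le_sum fun j (_ : j ∈ Finset.univ) => hpt j
  simp only [Finset.sum_add_distrib, ← Finset.mul_sum] at hsum
  rw [hX'] at h1
  have h3 : ∑ j : Fin n, (svN X j - max (svN W j - t j) 0) ^ 2 ≤ 0 := by
    nlinarith
  have h4 := (Finset.sum_eq_zero_iff_of_nonneg (fun j _ => sq_nonneg _)).1
    (le_antisymm h3 (Finset.sum_nonneg fun j _ => sq_nonneg _)) ⟨i, not_le.1 hi⟩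
    (Finset.mem_univ _)
  exact sub_eq_zero.1 (pow_eq_zero_iff two_ne_zero |>.1 h4)

end Tail

/-! ### Extrapolation of low-rank matrices. -/

section Extrapolation

variable {m n : ℕ}

theorem IsSVD.norm_apply_sq {X : Mat m n} {s : ℕ → ℝ}
    {v : OrthonormalBasis (Fin n) ℝ (EuclideanSpace ℝ (Fin n))}
    {u : Fin n → EuclideanSpace ℝ (Fin m)} (h : IsSVD X s v u) (y : EuclideanSpace ℝ (Fin n)) :
    ‖Matrix.toEuclideanLin X y‖ ^ 2 = ∑ i : Fin n, s i ^ 2 * ⟪v i, y⟫_ℝ ^ 2 := by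
  conv_lhs => rw [← v.sum_repr' y, map_sum]
  rw [← real_inner_self_eq_norm_sq, sum_inner]
  refine Finset.sum_congr rfl fun i _ => ?_
  rw [inner_sum, Finset.sum_eq_single i]
  · rw [map_smul, h.apply, real_inner_self_eq_norm_sq, norm_smul, norm_smul, mul_pow, mul_pow,
      Real.norm_eq_abs, Real.norm_eq_abs, sq_abs, sq_abs]
    by_cases hi : s i = 0
    · simp [hi]
    · rw [h.norm_eq i hi]
      ring
  · intro j _ hj
    rw [map_smul, map_smul, h.apply, h.apply]
    simp only [inner_smul_left, inner_smul_right, h.orthogonal i j hj.symm, mul_zero]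
  · simp

/-- A linear extrapolation through two matrices of rank at most `r` is, up to a term of second
order, again a matrix of rank at most `r`. -/
theorem exists_rank_le_extrapolation {X X₀ : Mat m n} {r : ℕ} {δ a : ℝ} (hrn : r ≤ n)
    (hX : svN X r = 0) (hX₀ : svN X₀ r = 0) (hδ : 0 < δ) (hsv : ∀ i < r, δ ≤ svN X i)
    (hE : ‖X - X₀‖ ≤ δ / 2) (ha : 0 ≤ a) :
    ∃ P : Mat m n, svN P r = 0 ∧
      ‖X + a • (X - X₀) - P‖ ≤ a * (1 + a) * (2 / δ * ‖X - X₀‖ ^ 2) := by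
  obtain ⟨v, u, h⟩ := exists_isSVD X
  have hzero : ∀ i, r ≤ i → svN X i = 0 := fun i hi =>
    le_antisymm ((svN_antitone X hi).trans hX.le) (svN_nonneg X i)
  set S : Submodule ℝ (EuclideanSpace ℝ (Fin n)) :=
    Submodule.span ℝ (Set.range fun i : Fin r => v (Fin.castLE hrn i)) with hS
  have hvS : ∀ i : Fin n, (i : ℕ) < r → v i ∈ S := fun i hi =>
    Submodule.subset_span ⟨⟨i, hi⟩, rfl⟩
  have hSdim : Module.finrank ℝ S = r := by
    rw [hS, finrank_span_eq_card, Fintype.card_fin]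
    exact (v.orthonormal.linearIndependent).comp _ (Fin.castLE_injective hrn)
  have hSperp : ∀ y ∈ S, ∀ i : Fin n, r ≤ i → ⟪v i, y⟫_ℝ = 0 := by
    intro y hy i hi
    induction hy using Submodule.span_induction with
    | mem x hx =>
      obtain ⟨j, rfl⟩ := hx
      refine v.inner_eq_zero fun hij => ?_
      have := j.2
      rw [hij] at hi
      simp at hi
      omega
    | zero => simp
    | add x y _ _ hx hy => rw [inner_add_right, hx, hy, add_zero]
    | smul c x _ hx => rw [inner_smul_right, hx, mul_zero]
  have hlow : ∀ y ∈ S, δ * ‖y‖ ≤ ‖Matrix.toEuclideanLin X y‖ := by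
    intro y hy
    refine abs_le_of_sq_le_sq' ?_ (norm_nonneg _) |>.2
    rw [h.norm_apply_sq, mul_pow, ← v.sum_sq_norm_inner_right y, Finset.mul_sum]
    refine Finset.sum_le_sum fun i _ => ?_
    rw [Real.norm_eq_abs, sq_abs]
    by_cases hi : r ≤ i
    · rw [hSperp y hy i hi]; simp
    · have := hsv i (not_le.1 hi)
      gcongr
  have hlow₀ : ∀ y ∈ S, δ / 2 * ‖y‖ ≤ ‖Matrix.toEuclideanLin X₀ y‖ := by
    intro y hy
    have h1 := hlow y hy
    have h2 := norm_toEuclideanLin_le (X - X₀) y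
    rw [map_sub, LinearMap.sub_apply] at h2
    have h3 := norm_sub_norm_le (Matrix.toEuclideanLin X y) (Matrix.toEuclideanLin X₀ y)
    nlinarith [norm_nonneg y]
  -- On the span `S` of the leading right singular vectors of `X`, the matrix `X₀` is still
  -- injective, so its image there already has dimension `r` and exhausts the range.
  have hrange : S.map (Matrix.toEuclideanLin X₀) = LinearMap.range (Matrix.toEuclideanLin X₀) := by
    refine Submodule.eq_of_le_of_finrank_le LinearMap.map_le_range ?_
    have h1 : Module.finrank ℝ (S.map (Matrix.toEuclideanLin X₀)) = r := by
      rw [← hSdim, ← LinearMap.range_domRestrict]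
      refine LinearMap.finrank_range_of_inj ?_
      rw [← LinearMap.ker_eq_bot, LinearMap.ker_eq_bot']
      intro y hy
      have := hlow₀ y y.2
      rw [LinearMap.domRestrict_apply] at hy
      rw [hy, norm_zero] at this
      have h2 : ‖(y : EuclideanSpace ℝ (Fin n))‖ ≤ 0 := by
        by_contra h3
        push Not at h3
        nlinarith [mul_pos (half_pos hδ) h3]
      exact Subtype.ext (norm_le_zero_iff.1 h2)
    rw [h1]
    exact (svN_eq_zero_iff X₀).1 hX₀
  have hex : ∀ i, ∃ p ∈ S, Matrix.toEuclideanLin X₀ p = Matrix.toEuclideanLin X₀ (v i) := by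
    intro i
    have : Matrix.toEuclideanLin X₀ (v i) ∈ S.map (Matrix.toEuclideanLin X₀) := by
      rw [hrange]; exact ⟨v i, rfl⟩
    simpa using this
  choose p hpS hp using hex
  set Pr : Mat n n := Matrix.toEuclideanLin.symm
    (v.toBasis.constr ℝ fun i : Fin n => if (i : ℕ) < r then v i else 0) with hPr
  set C : Mat n n := Matrix.toEuclideanLin.symm (v.toBasis.constr ℝ p) with hC
  have hPrv : ∀ i : Fin n, Matrix.toEuclideanLin Pr (v i) = if (i : ℕ) < r then v i else 0 := by
    intro i
    rw [hPr, LinearEquiv.apply_symm_apply, ← v.coe_toBasis, Module.Basis.constr_basis]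
  have hCv : ∀ i, Matrix.toEuclideanLin C (v i) = p i := by
    intro i
    rw [hC, LinearEquiv.apply_symm_apply, ← v.coe_toBasis, Module.Basis.constr_basis]
  have hPrS : ∀ i : Fin n, Matrix.toEuclideanLin Pr (v i) ∈ S := by
    intro i
    rw [hPrv]
    split_ifs with hi
    exacts [hvS i hi, S.zero_mem]
  have hext : ∀ {k : ℕ} {A B : Mat k n}, (∀ i, Matrix.toEuclideanLin A (v i) =
      Matrix.toEuclideanLin B (v i)) → A = B := by
    intro k A B hAB
    refine Matrix.toEuclideanLin.injective (v.toBasis.ext fun i => ?_)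
    rw [v.coe_toBasis]
    exact hAB i
  have hmul : ∀ {k : ℕ} (A : Mat k n) (B : Mat n n) y, Matrix.toEuclideanLin (A * B) y =
      Matrix.toEuclideanLin A (Matrix.toEuclideanLin B y) := by
    intro k A B y
    rw [Matrix.toLpLin_mul_same, LinearMap.comp_apply]
  have hXv : ∀ i : Fin n, r ≤ i → Matrix.toEuclideanLin X (v i) = 0 := fun i hi => by
    rw [h.apply, hzero i hi, zero_smul]
  have hXPr : X * Pr = X := hext fun i => by
    rw [hmul, hPrv]
    split_ifs with hi
    · rfl
    · rw [map_zero, hXv i (not_lt.1 hi)]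
  have hXC : X₀ * C = X₀ := hext fun i => by rw [hmul, hCv, hp]
  -- `Pr` and `C` map into `S`, with `X * Pr = X` and `X₀ * C = X₀`. The right factor therefore has
  -- rank at most `r`, and the first-order terms cancel, leaving a multiple of `(X - X₀) * (Pr -
  -- C)`, a product of two small factors.
  refine ⟨(X + a • (X - X₀)) * ((1 + a) • Pr - a • C), ?_, ?_⟩
  · rw [svN_eq_zero_iff, Matrix.toLpLin_mul_same, LinearMap.range_comp]
    refine (Submodule.finrank_map_le _ _).trans ?_
    rw [← hSdim]
    refine Submodule.finrank_mono ?_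
    rintro _ ⟨y, rfl⟩
    rw [← v.sum_repr' y, map_sum]
    refine S.sum_mem fun i _ => ?_
    rw [map_smul, map_sub, map_smul, map_smul, LinearMap.sub_apply, LinearMap.smul_apply,
      LinearMap.smul_apply, hCv]
    exact S.smul_mem _ (S.sub_mem (S.smul_mem _ (hPrS i)) (S.smul_mem _ (hpS i)))
  · have key : X + a • (X - X₀) - (X + a • (X - X₀)) * ((1 + a) • Pr - a • C) =
        -(a * (1 + a)) • ((X - X₀) * (Pr - C)) := by
      simp only [Matrix.mul_sub, Matrix.sub_mul, Matrix.add_mul, Matrix.smul_mul, Matrix.mul_smul,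
        hXPr, hXC]
      module
    have hPC : δ / 2 * ‖Pr - C‖ ≤ ‖X - X₀‖ := by
      refine abs_le_of_sq_le_sq' ?_ (norm_nonneg _) |>.2
      rw [mul_pow, norm_sq_eq_sum_basis v, norm_sq_eq_sum_basis v, Finset.mul_sum]
      refine Finset.sum_le_sum fun i _ => ?_
      rw [← mul_pow]
      refine pow_le_pow_left₀ (by positivity) ?_ 2
      have hmem : Matrix.toEuclideanLin (Pr - C) (v i) ∈ S := by
        rw [map_sub, LinearMap.sub_apply, hCv]
        exact S.sub_mem (hPrS i) (hpS i)
      refine (hlow₀ _ hmem).trans ?_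
      rw [map_sub Matrix.toEuclideanLin Pr, LinearMap.sub_apply, hCv, map_sub, hp, hPrv,
        map_sub Matrix.toEuclideanLin X, LinearMap.sub_apply]
      split_ifs with hi
      · simp
      · rw [hXv i (not_lt.1 hi), map_zero]
    rw [key, norm_smul, norm_neg, Real.norm_of_nonneg (by positivity)]
    refine mul_le_mul_of_nonneg_left ?_ (by positivity)
    refine (Matrix.frobenius_norm_mul _ _).trans ?_
    have h1 : ‖Pr - C‖ ≤ 2 / δ * ‖X - X₀‖ := by
      rw [div_mul_eq_mul_div, le_div_iff₀ hδ]
      linarith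
    calc ‖X - X₀‖ * ‖Pr - C‖ ≤ ‖X - X₀‖ * (2 / δ * ‖X - X₀‖) := by gcongr
      _ = _ := by ring

end Extrapolation

/-! ### Gradients of smooth convex functions. -/

section Gradient

variable {m n : ℕ} {F : Mat m n → ℝ}

theorem fderiv_eq_inner_grad (F : Mat m n → ℝ) (X D : Mat m n) :
    fderiv ℝ F X D = ⟪grad F X, D⟫_ℝ := by
  conv_lhs => rw [Matrix.matrix_eq_sum_single D]
  rw [inner_eq_ip, ip_eq_sum, map_sum, Finset.sum_comm]
  refine Finset.sum_congr rfl fun i _ => ?_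
  rw [map_sum]
  refine Finset.sum_congr rfl fun j _ => ?_
  have : Matrix.single i j (D i j) = D i j • (Matrix.single i j 1 : Mat m n) := by
    rw [Matrix.smul_single, smul_eq_mul, mul_one]
  rw [this, map_smul, grad, Matrix.of_apply, smul_eq_mul, mul_comm]

theorem hasDerivAt_line (hF : Differentiable ℝ F) (X D : Mat m n) (t : ℝ) :
    HasDerivAt (fun t : ℝ => F (X + t • D)) ⟪grad F (X + t • D), D⟫_ℝ t := by
  have h1 : HasDerivAt (fun t : ℝ => X + t • D) D t := by
    have h := ((hasDerivAt_id t).smul_const D).const_add X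
    rwa [one_smul] at h
  have h2 := (hF (X + t • D)).hasFDerivAt.comp_hasDerivAt t h1
  rw [← fderiv_eq_inner_grad]
  exact h2

theorem add_inner_grad_le (hF : Differentiable ℝ F) (hc : ConvexOn ℝ univ F) (X Y : Mat m n) :
    F X + ⟪grad F X, Y - X⟫_ℝ ≤ F Y := by
  have hline : ConvexOn ℝ univ (fun t : ℝ => F (X + t • (Y - X))) := by
    have := hc.comp_affineMap (AffineMap.lineMap X Y)
    rw [preimage_univ] at this
    refine this.congr fun t _ => ?_
    simp only [Function.comp_apply, AffineMap.lineMap_apply, vsub_eq_sub, vadd_eq_add]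
    rw [add_comm]
  have h1 := hline.le_slope_of_hasDerivAt (mem_univ (0 : ℝ)) (mem_univ (1 : ℝ)) zero_lt_one
    (hasDerivAt_line hF X (Y - X) 0)
  simp only [slope_def_field, zero_smul, one_smul, add_zero, sub_zero, div_one,
    add_sub_cancel] at h1
  linarith

/-- The descent lemma for functions with Lipschitz gradient. -/
theorem le_add_inner_grad_add (hF : Differentiable ℝ F) {L : ℝ}
    (hL : ∀ X Y, ‖grad F X - grad F Y‖ ≤ L * ‖X - Y‖) (X Y : Mat m n) :
    F Y ≤ F X + ⟪grad F X, Y - X⟫_ℝ + L / 2 * ‖Y - X‖ ^ 2 := by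
  set D := Y - X with hD
  set g : ℝ → ℝ := fun t => F (X + t • D) - t * ⟪grad F X, D⟫_ℝ - L / 2 * ‖D‖ ^ 2 * t ^ 2 with hg
  have hd : ∀ t, HasDerivAt g (⟪grad F (X + t • D), D⟫_ℝ - ⟪grad F X, D⟫_ℝ
      - L / 2 * ‖D‖ ^ 2 * (2 * t)) t := by
    intro t
    have h1 := (hasDerivAt_id t).mul_const ⟪grad F X, D⟫_ℝ
    have h2 := ((hasDerivAt_id t).pow 2).const_mul (L / 2 * ‖D‖ ^ 2)
    convert! ((hasDerivAt_line hF X D t).sub h1).sub h2 using 1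
    simp
  have hanti : AntitoneOn g (Icc 0 1) := by
    refine antitoneOn_of_deriv_nonpos (convex_Icc 0 1)
      (fun t _ => (hd t).continuousAt.continuousWithinAt)
      (fun t _ => (hd t).differentiableAt.differentiableWithinAt) fun t ht => ?_
    rw [interior_Icc] at ht
    rw [(hd t).deriv, ← inner_sub_left]
    have h1 := real_inner_le_norm (grad F (X + t • D) - grad F X) D
    have h2 := hL (X + t • D) X
    rw [add_sub_cancel_left, norm_smul, Real.norm_of_nonneg ht.1.le] at h2
    nlinarith [norm_nonneg D]
  have h01 := hanti (left_mem_Icc.2 zero_le_one) (right_mem_Icc.2 zero_le_one) zero_le_one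
  simp only [hg, one_smul, zero_smul, add_zero, hD, add_sub_cancel] at h01
  linarith

/-- If the gradient exceeded `L`, convexity would make `F` outgrow the `L`-Lipschitz `f` linearly
along the gradient direction, contradicting `|F - f| ≤ C`. The bound does not depend on `C`. -/
theorem norm_grad_le (hF : Differentiable ℝ F) (hc : ConvexOn ℝ univ F) {f : Mat m n → ℝ}
    {L C : ℝ} (hL : 0 ≤ L) (hf : ∀ X Y, |f X - f Y| ≤ L * ‖X - Y‖) (hfF : ∀ X, |F X - f X| ≤ C)
    (X : Mat m n) :
    ‖grad F X‖ ≤ L := by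
  set G := grad F X with hG
  by_contra hlt
  push Not at hlt
  have hbound : ∀ t : ℝ, 0 ≤ t → t * (‖G‖ * (‖G‖ - L)) ≤ 2 * C := by
    intro t ht
    have h1 := add_inner_grad_le hF hc X (X + t • G)
    rw [add_sub_cancel_left, inner_smul_right, real_inner_self_eq_norm_sq] at h1
    have h2 := (abs_le.1 (hf (X + t • G) X)).2
    rw [add_sub_cancel_left, norm_smul, Real.norm_of_nonneg ht] at h2
    have h3 := (abs_le.1 (hfF X)).1
    have h4 := (abs_le.1 (hfF (X + t • G))).2
    nlinarith
  have hpos : 0 < ‖G‖ * (‖G‖ - L) := mul_pos (hL.trans_lt hlt) (sub_pos.2 hlt)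
  have hC : 0 ≤ C := (abs_nonneg _).trans (hfF X)
  have h1 := hbound ((2 * C + 1) / (‖G‖ * (‖G‖ - L))) (by positivity)
  rw [div_mul_cancel₀ _ hpos.ne'] at h1
  linarith

theorem sub_le_mul_norm_sub (hF : Differentiable ℝ F) (hc : ConvexOn ℝ univ F) {L : ℝ}
    (hL : ∀ X, ‖grad F X‖ ≤ L) (X Y : Mat m n) : F Y - F X ≤ L * ‖Y - X‖ := by
  have h1 := add_inner_grad_le hF hc Y X
  have h2 := real_inner_le_norm (grad F Y) (Y - X)
  rw [← neg_sub Y X, inner_neg_right] at h1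
  nlinarith [hL Y, norm_nonneg (Y - X)]

end Gradient

/-- The hypotheses on the problem, the smoothing function, the parameters and the iterates. -/
structure Setup {m n : ℕ} (f : Mat m n → ℝ) (ft : Mat m n → ℝ → ℝ)
    (lam v Lf μbar κ Lt s ε α : ℝ) (a b h : ℕ → ℝ) (X : ℕ → Mat m n) (μ : ℕ → ℝ) : Prop where
  prob : IsProblem f lam v Lf
  smooth : IsSmoothing f ft μbar κ Lt
  param : IsParam s ε Lt a b h μ
  run : IsRun ft lam v μbar κ s α a b h X μ

/-- The difference `X^k - X^{k-1}` of successive iterates. -/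
def incr {m n : ℕ} (X : ℕ → Mat m n) (k : ℕ) : Mat m n := X k - X (k - 1)

/-! ### The penalty and its majorants. -/

section Penalty

variable {m n : ℕ} {v : ℝ}

theorem phi_le (j : ℕ) (t : ℝ) : phi v t ≤ t / v - theta v j t := by
  rw [phi, theta]
  split_ifs
  · simp
  · simp

theorem Phi_le_PhiD (d : Fin n → ℕ) (X : Mat m n) : Phi v X ≤ PhiD v d X :=
  Finset.sum_le_sum fun i _ => phi_le (d i) (sv X i)

theorem PhiD_dvec (hv : 0 < v) (X : Mat m n) : PhiD v (dvec v X) X = Phi v X := by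
  refine Finset.sum_congr rfl fun i _ => ?_
  rw [phi, theta, dvec]
  split_ifs with h1 h2 h2
  · rw [min_eq_right ((div_le_one hv).2 h1.le), sub_zero]
  · exact absurd rfl h2
  · norm_num at h2
  · rw [min_eq_left ((one_le_div hv).2 (not_lt.1 h1))]
    ring

theorem Phi_nonneg (hv : 0 < v) (X : Mat m n) : 0 ≤ Phi v X :=
  Finset.sum_nonneg fun i _ => le_min zero_le_one (div_nonneg (svN_nonneg X i) hv.le)

end Penalty

namespace Setup

variable {m n : ℕ} {f : Mat m n → ℝ} {ft : Mat m n → ℝ → ℝ}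
  {lam v Lf μbar κ Lt s ε α : ℝ} {a b h : ℕ → ℝ} {X : ℕ → Mat m n} {μ : ℕ → ℝ}

/-! ### Smoothing and step parameters. -/

section Parameters

theorem exists_mu_succ (S : Setup f ft lam v Lf μbar κ Lt s ε α a b h X μ) (k : ℕ) :
    μ (k + 1) = μ k ∨ μ (k + 1) = μ 0 / ((k : ℝ) + 1) ^ s := by
  by_cases hk : H ft lam v κ a h μ X (k + 1) - H ft lam v κ a h μ X k ≤ -α * μ k ^ 2
  · exact Or.inl (S.run.keep k hk)
  · exact Or.inr (S.run.reduce k hk)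

theorem mu_pos (S : Setup f ft lam v Lf μbar κ Lt s ε α a b h X μ) (k : ℕ) : 0 < μ k := by
  induction k with
  | zero => exact S.run.μ_zero_mem.1
  | succ k ih =>
    rcases S.exists_mu_succ k with h1 | h1
    · rwa [h1]
    · rw [h1]
      exact div_pos S.run.μ_zero_mem.1 (Real.rpow_pos_of_pos (by positivity) _)

theorem le_mu (S : Setup f ft lam v Lf μbar κ Lt s ε α a b h X μ) (k : ℕ) :
    μ 0 / ((k : ℝ) + 1) ^ s ≤ μ k := by
  have h0 := S.run.μ_zero_mem.1
  have hs := S.run.s_mem.1.le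
  induction k with
  | zero => simp
  | succ k ih =>
    have h2 : μ 0 / (((k + 1 : ℕ) : ℝ) + 1) ^ s ≤ μ 0 / ((k : ℝ) + 1) ^ s := by
      push_cast
      gcongr
      linarith
    rcases S.exists_mu_succ k with h1 | h1
    · rw [h1]
      exact h2.trans ih
    · rw [h1]
      exact h2

theorem mu_antitone (S : Setup f ft lam v Lf μbar κ Lt s ε α a b h X μ) : Antitone μ := by
  refine antitone_nat_of_succ_le fun k => ?_
  rcases S.exists_mu_succ k with h1 | h1
  · exact h1.le
  · rw [h1]
    exact S.le_mu k

theorem mu_mem (S : Setup f ft lam v Lf μbar κ Lt s ε α a b h X μ) (k : ℕ) :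
    μ k ∈ Ioc 0 μbar :=
  ⟨S.mu_pos k, (S.mu_antitone (Nat.zero_le k)).trans S.run.μ_zero_mem.2⟩

theorem tendsto_mu (S : Setup f ft lam v Lf μbar κ Lt s ε α a b h X μ)
    (hN : (Ns μ).Infinite) : Tendsto μ atTop (𝓝 0) := by
  have hs := S.run.s_mem.1
  have hlim : Tendsto (fun k : ℕ => μ 0 / ((k : ℝ) + 1) ^ s) atTop (𝓝 0) :=
    tendsto_const_nhds.div_atTop ((tendsto_rpow_atTop hs).comp
      (tendsto_atTop_add_const_right _ _ tendsto_natCast_atTop_atTop))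
  rw [Metric.tendsto_atTop] at hlim ⊢
  intro δ hδ
  obtain ⟨K, hK⟩ := hlim δ hδ
  obtain ⟨k, hk, hKk⟩ := hN.exists_gt K
  refine ⟨k + 1, fun l hl => ?_⟩
  have h1 := hK k hKk.le
  rw [← (S.exists_mu_succ k).resolve_left hk] at h1
  rw [Real.dist_0_eq_abs, abs_of_pos (S.mu_pos _)] at h1 ⊢
  exact (S.mu_antitone hl).trans_lt h1

/-- The factor `1 / 2` matters in `dead_succ`, where the inertial gain is counted twice. -/
theorem a_lt_half (S : Setup f ft lam v Lf μbar κ Lt s ε α a b h X μ) (k : ℕ) : a k < 1 / 2 := by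
  refine (S.param.a_lt k).trans_le ?_
  have h1 : (1 : ℝ) ≤ 2 ^ s := Real.one_le_rpow one_le_two S.run.s_mem.1.le
  rw [div_le_div_iff₀ (by linarith) two_pos]
  nlinarith [S.param.ε_pos]

theorem ratio_nonneg (S : Setup f ft lam v Lf μbar κ Lt s ε α a b h X μ) (k : ℕ) :
    0 ≤ 1 - a k - (a k + ε) * (μ k / μ (k + 1)) := by
  have h1 := S.param.h_bound₁ k
  have h2 := mul_nonneg (sub_nonneg.2 (S.param.b_mem k).2) S.smooth.Lt_pos.le
  exact nonneg_of_mul_nonneg_right (h2.trans h1) (S.param.h_pos k)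

theorem mul_mu_le (S : Setup f ft lam v Lf μbar κ Lt s ε α a b h X μ) (k : ℕ) :
    ε * μ k ≤ μ (k + 1) := by
  have h1 := S.ratio_nonneg k
  have h2 : 0 < μ k / μ (k + 1) := div_pos (S.mu_pos _) (S.mu_pos _)
  have h3 : ε * (μ k / μ (k + 1)) ≤ 1 := by nlinarith [S.param.a_nonneg k]
  rwa [← mul_div_assoc, div_le_one (S.mu_pos _)] at h3

/-- Adding the two parameter bounds cancels `a k` and `b k`. -/
theorem Lt_le_h (S : Setup f ft lam v Lf μbar κ Lt s ε α a b h X μ) (k : ℕ) : Lt ≤ h k := by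
  have h1 := S.param.h_bound₁ k
  have h2 := S.param.h_bound₂ k
  have h3 : 0 < μ k / μ (k + 1) := div_pos (S.mu_pos _) (S.mu_pos _)
  have h4 := mul_nonneg (add_nonneg (S.param.a_nonneg k) S.param.ε_pos.le) h3.le
  nlinarith [S.param.h_pos k]

theorem slope_pos (S : Setup f ft lam v Lf μbar κ Lt s ε α a b h X μ) : 0 < lam / v - Lf := by
  have := (lt_div_iff₀ S.prob.Lf_pos).1 S.prob.v_lt
  rw [sub_pos, lt_div_iff₀ S.prob.v_pos]
  linarith

end Parameters

/-! ### Energy descent and vanishing increments. -/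

section Descent

theorem differentiable_ft (S : Setup f ft lam v Lf μbar κ Lt s ε α a b h X μ) (k : ℕ) :
    Differentiable ℝ fun W => ft W (μ k) :=
  (S.smooth.contDiff _ (S.mu_mem k)).differentiable one_ne_zero

theorem norm_grad_ft_le (S : Setup f ft lam v Lf μbar κ Lt s ε α a b h X μ) (k : ℕ)
    (Z : Mat m n) : ‖grad (fun W => ft W (μ k)) Z‖ ≤ Lf :=
  norm_grad_le (S.differentiable_ft k) (S.smooth.convex _ (S.mu_mem k)) S.prob.Lf_pos.le
    S.prob.lipschitz (fun W => S.smooth.approx W _ (S.mu_mem k)) Z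

theorem ft_sub_le (S : Setup f ft lam v Lf μbar κ Lt s ε α a b h X μ) (k : ℕ) (Y Z : Mat m n) :
    ft Z (μ k) - ft Y (μ k) ≤ Lf * ‖Z - Y‖ :=
  sub_le_mul_norm_sub (S.differentiable_ft k) (S.smooth.convex _ (S.mu_mem k))
    (S.norm_grad_ft_le k) Y Z

/-- The term `κ * μ` in `H` absorbs the change of the smoothed function when `μ` is lowered. -/
theorem ft_mu_le (S : Setup f ft lam v Lf μbar κ Lt s ε α a b h X μ) (k : ℕ) (Y : Mat m n) :
    ft Y (μ k) + κ * μ k ≤ ft Y (μ (k - 1)) + κ * μ (k - 1) := by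
  have h1 := S.mu_antitone (Nat.sub_le k 1)
  have h2 := S.smooth.lipschitz_param Y (μ (k - 1)) (Ioc_subset_Icc_self (S.mu_mem _)) (μ k)
    (Ioc_subset_Icc_self (S.mu_mem _))
  rw [abs_of_nonneg (sub_nonneg.2 h1)] at h2
  linarith [(abs_le.1 h2).2]

/-- The minimizer is compared with `X k`, where the majorant `PhiD` touches `Phi`. -/
theorem penalty_sub_le (S : Setup f ft lam v Lf μbar κ Lt s ε α a b h X μ) (k : ℕ) :
    lam * (Phi v (X (k + 1)) - Phi v (X k)) ≤
      -⟪incr X (k + 1), grad (fun W => ft W (μ k)) (extrap X (b k) k)⟫_ℝ -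
        h k * (μ k)⁻¹ / 2 *
          (‖incr X (k + 1)‖ ^ 2 - 2 * a k * ⟪incr X (k + 1), incr X k⟫_ℝ) := by
  have h1 : Q ft lam v (h k) (dvec v (X k)) (extrap X (a k) k) (extrap X (b k) k) (μ k)
      (X (k + 1)) ≤ Q ft lam v (h k) (dvec v (X k)) (extrap X (a k) k) (extrap X (b k) k) (μ k)
      (X k) := S.run.step k (mem_univ _)
  have h2 := Phi_le_PhiD (v := v) (dvec v (X k)) (X (k + 1))
  simp only [Q, ← inner_eq_ip, PhiD_dvec S.prob.v_pos] at h1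
  set G := grad (fun W => ft W (μ k)) (extrap X (b k) k)
  have e1 : X (k + 1) - extrap X (a k) k = incr X (k + 1) - a k • incr X k := by
    simp only [extrap, incr, Nat.add_sub_cancel]
    abel
  have e2 : X k - extrap X (a k) k = -(a k • incr X k) := by
    simp only [extrap, incr]
    abel
  rw [e1, e2, norm_sub_sq_real, inner_sub_left, inner_neg_left, norm_neg, inner_smul_right] at h1
  have h3 := mul_le_mul_of_nonneg_left h2 S.prob.lam_pos.le
  linarith

theorem H_succ_sub_le (S : Setup f ft lam v Lf μbar κ Lt s ε α a b h X μ) (k : ℕ) :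
    H ft lam v κ a h μ X (k + 1) - H ft lam v κ a h μ X k ≤
      ft (X (k + 1)) (μ k) - ft (X k) (μ k) + lam * (Phi v (X (k + 1)) - Phi v (X k)) +
      h k * a k / 2 * (μ (k + 1))⁻¹ * ‖incr X (k + 1)‖ ^ 2 -
      h k * a k / 2 * (μ k)⁻¹ * ‖incr X k‖ ^ 2 := by
  have h1 := S.ft_mu_le k (X k)
  have h2 : h (k + 1) * a (k + 1) ≤ h k * a k :=
    mul_le_mul (S.param.h_antitone k.le_succ) (S.param.a_antitone k.le_succ)
      (S.param.a_nonneg _) (S.param.h_pos _).le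
  have h3 : 0 ≤ (μ (k + 1))⁻¹ * ‖incr X (k + 1)‖ ^ 2 :=
    mul_nonneg (inv_nonneg.2 (S.mu_pos _).le) (sq_nonneg _)
  have h4 := mul_le_mul_of_nonneg_right h2 h3
  simp only [H, Nat.add_sub_cancel]
  change _ + h (k + 1) * a (k + 1) / 2 * (μ (k + 1))⁻¹ * ‖incr X (k + 1)‖ ^ 2 -
    (_ + h k * a k / 2 * (μ k)⁻¹ * ‖incr X k‖ ^ 2) ≤ _
  linarith

/-- Sufficient decrease of the auxiliary sequence. -/
theorem H_succ_sub_le_neg (S : Setup f ft lam v Lf μbar κ Lt s ε α a b h X μ) (k : ℕ) :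
    H ft lam v κ a h μ X (k + 1) - H ft lam v κ a h μ X k ≤
      -(h k * ε / 2 * (μ (k + 1))⁻¹ * ‖incr X (k + 1)‖ ^ 2) := by
  refine (S.H_succ_sub_le k).trans ?_
  have h1 := S.penalty_sub_le k
  set D := incr X (k + 1) with hD
  set E := incr X k with hE
  set Z := extrap X (b k) k with hZ
  set G := grad (fun W => ft W (μ k)) Z with hG
  have hconv := add_inner_grad_le (S.differentiable_ft k) (S.smooth.convex _ (S.mu_mem k)) Z (X k)
  have hdesc := le_add_inner_grad_add (S.differentiable_ft k)
    (S.smooth.lipschitz_grad _ (S.mu_mem k)) Z (X (k + 1))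
  have e1 : X (k + 1) - Z = D - b k • E := by
    simp only [hD, hE, hZ, extrap, incr, Nat.add_sub_cancel]
    abel
  have e2 : X k - Z = -(b k • E) := by
    simp only [hE, hZ, extrap, incr]
    abel
  rw [e1, norm_sub_sq_real, inner_sub_right, inner_smul_right, inner_smul_right, norm_smul,
    mul_pow, Real.norm_eq_abs, sq_abs, ← hG] at hdesc
  rw [e2, inner_neg_right, inner_smul_right, ← hG] at hconv
  have hz : 2 * ⟪D, E⟫_ℝ ≤ ‖D‖ ^ 2 + ‖E‖ ^ 2 := by
    have := norm_sub_sq_real D E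
    nlinarith [sq_nonneg ‖D - E‖]
  have hp := inv_pos.2 (S.mu_pos k)
  have hb := S.param.b_mem k
  -- After convexity at `X k` and the descent lemma at `X (k + 1)` are combined, the gradient terms
  -- cancel. `hc2` is the sign of the coefficient of `⟪D, E⟫`, so `hz` applies; then `hc1` controls
  -- the coefficient of `‖D‖ ^ 2` and `hc3` that of `‖E‖ ^ 2`.
  have hc1 : (1 - b k) * Lt * (μ k)⁻¹ ≤
      h k * (1 - a k) * (μ k)⁻¹ - h k * (a k + ε) * (μ (k + 1))⁻¹ := by
    have h2 := mul_le_mul_of_nonneg_right (S.param.h_bound₁ k) hp.le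
    have h3 : h k * (1 - a k - (a k + ε) * (μ k / μ (k + 1))) * (μ k)⁻¹ =
      h k * (1 - a k) * (μ k)⁻¹ - h k * (a k + ε) * (μ (k + 1))⁻¹ := by
      have h4 := (S.mu_pos k).ne'
      have h5 := (S.mu_pos (k + 1)).ne'
      field_simp
    linarith
  have hc2 : 0 ≤ (h k * a k - b k * Lt) * (μ k)⁻¹ :=
    mul_nonneg (sub_nonneg.2 (S.param.h_bound₂ k)) hp.le
  have hc3 : 0 ≤ Lt * (μ k)⁻¹ * (b k * (1 - b k)) * ‖E‖ ^ 2 :=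
    mul_nonneg (mul_nonneg (mul_nonneg S.smooth.Lt_pos.le hp.le)
      (mul_nonneg hb.1 (sub_nonneg.2 hb.2))) (sq_nonneg _)
  have hm1 := mul_le_mul_of_nonneg_right hc1 (sq_nonneg ‖D‖)
  have hm2 := mul_le_mul_of_nonneg_left hz hc2
  rw [real_inner_comm G D] at h1
  linarith

theorem H_nonneg (S : Setup f ft lam v Lf μbar κ Lt s ε α a b h X μ) (k : ℕ) :
    0 ≤ H ft lam v κ a h μ X k := by
  have h1 := (abs_le.1 (S.smooth.approx (X k) _ (S.mu_mem (k - 1)))).1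
  have h2 := S.prob.nonneg (X k)
  have h3 := mul_nonneg S.prob.lam_pos.le (Phi_nonneg S.prob.v_pos (X k))
  have h4 : 0 ≤ h k * a k / 2 * (μ k)⁻¹ * ‖X k - X (k - 1)‖ ^ 2 := by
    have := S.param.h_pos k
    have := S.param.a_nonneg k
    have := S.mu_pos k
    positivity
  rw [H]
  linarith

theorem H_antitone (S : Setup f ft lam v Lf μbar κ Lt s ε α a b h X μ) :
    Antitone (H ft lam v κ a h μ X) := by
  refine antitone_nat_of_succ_le fun k => ?_
  have h1 := S.H_succ_sub_le_neg k
  have h2 : 0 ≤ h k * ε / 2 * (μ (k + 1))⁻¹ * ‖incr X (k + 1)‖ ^ 2 := by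
    have := S.param.h_pos k
    have := S.param.ε_pos
    have := S.mu_pos (k + 1)
    positivity
  linarith

/-- `H` converges, so its drops tend to zero, and each drop dominates `‖incr X (k + 1)‖ ^ 2 / μ (k +
1)` up to the uniform factor `Lt * ε / 2`. -/
theorem eventually_norm_incr_sq_le (S : Setup f ft lam v Lf μbar κ Lt s ε α a b h X μ)
    {δ : ℝ} (hδ : 0 < δ) : ∀ᶠ k in atTop, ‖incr X k‖ ^ 2 ≤ δ * μ k := by
  have hbdd : BddBelow (range (H ft lam v κ a h μ X)) :=
    ⟨0, by rintro _ ⟨k, rfl⟩; exact S.H_nonneg k⟩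
  have hlim := tendsto_atTop_ciInf S.H_antitone hbdd
  have hdiff := hlim.sub (hlim.comp (tendsto_add_atTop_nat 1))
  rw [sub_self] at hdiff
  have hLt := S.smooth.Lt_pos
  have hε := S.param.ε_pos
  have hev := hdiff.eventually (gt_mem_nhds (by positivity : 0 < Lt * ε / 2 * δ))
  rw [← map_add_atTop_eq_nat 1, eventually_map]
  filter_upwards [hev] with k hk
  have h1 := S.H_succ_sub_le_neg k
  have h2 : Lt * ε / 2 * (μ (k + 1))⁻¹ * ‖incr X (k + 1)‖ ^ 2 ≤
      h k * ε / 2 * (μ (k + 1))⁻¹ * ‖incr X (k + 1)‖ ^ 2 := by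
    have := S.Lt_le_h k
    have := S.mu_pos (k + 1)
    gcongr
  have h3 : Lt * ε / 2 * ((μ (k + 1))⁻¹ * ‖incr X (k + 1)‖ ^ 2) < Lt * ε / 2 * δ := by
    simp only [Function.comp_apply] at hk
    linarith
  have h4 := lt_of_mul_lt_mul_left h3 (by positivity)
  rw [inv_mul_lt_iff₀ (S.mu_pos _)] at h4
  linarith

end Descent

end Setup

namespace Setup

variable {m n : ℕ} {f : Mat m n → ℝ} {ft : Mat m n → ℝ → ℝ}
  {lam v Lf μbar κ Lt s ε α : ℝ} {a b h : ℕ → ℝ} {X : ℕ → Mat m n} {μ : ℕ → ℝ}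

/-! ### Sharper increment bounds where the smoothing parameter changes. -/

section Reduction

theorem neg_lt_of_mem_Ns (S : Setup f ft lam v Lf μbar κ Lt s ε α a b h X μ) {k : ℕ}
    (hk : k ∈ Ns μ) :
    -(α * μ k ^ 2) < H ft lam v κ a h μ X (k + 1) - H ft lam v κ a h μ X k := by
  by_contra hle
  exact hk (S.run.keep k (by linarith))

theorem mul_norm_incr_succ_sq_lt (S : Setup f ft lam v Lf μbar κ Lt s ε α a b h X μ) {k : ℕ}
    (hk : k ∈ Ns μ) :
    h k * ε / 2 * (μ (k + 1))⁻¹ * ‖incr X (k + 1)‖ ^ 2 < α * μ k ^ 2 := by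
  linarith [S.neg_lt_of_mem_Ns hk, S.H_succ_sub_le_neg k]

/-- The failed test caps the guaranteed decrease by `α * μ k ^ 2`, so the squared increment is of
order `μ k ^ 3`. -/
theorem eventually_norm_incr_succ_le (S : Setup f ft lam v Lf μbar κ Lt s ε α a b h X μ)
    (hN : (Ns μ).Infinite) {δ : ℝ} (hδ : 0 < δ) :
    ∀ᶠ k in atTop, k ∈ Ns μ → ‖incr X (k + 1)‖ ≤ δ * μ k := by
  have hLt := S.smooth.Lt_pos
  have hε := S.param.ε_pos
  have hα := S.run.α_pos
  filter_upwards [(S.tendsto_mu hN).eventually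
    (gt_mem_nhds (by positivity : 0 < δ ^ 2 * (Lt * ε / 2) / α))] with k hk hkN
  have h0 := S.mu_pos k
  have h1 := S.mul_norm_incr_succ_sq_lt hkN
  have h2 : Lt * ε / 2 * (μ k)⁻¹ * ‖incr X (k + 1)‖ ^ 2 ≤
      h k * ε / 2 * (μ (k + 1))⁻¹ * ‖incr X (k + 1)‖ ^ 2 := by
    have := S.Lt_le_h k
    have := S.param.h_pos k
    have := S.mu_antitone k.le_succ
    have := S.mu_pos (k + 1)
    gcongr
  rw [lt_div_iff₀ hα] at hk
  refine abs_le_of_sq_le_sq' ?_ (by positivity) |>.2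
  have h3 : (μ k)⁻¹ * (Lt * ε / 2 * ‖incr X (k + 1)‖ ^ 2) < α * μ k ^ 2 := by linarith
  rw [inv_mul_lt_iff₀ h0] at h3
  have h4 : μ k ^ 2 * (μ k * α) ≤ μ k ^ 2 * (δ ^ 2 * (Lt * ε / 2)) :=
    mul_le_mul_of_nonneg_left hk.le (sq_nonneg _)
  have h5 : Lt * ε / 2 * ‖incr X (k + 1)‖ ^ 2 ≤ Lt * ε / 2 * (δ * μ k) ^ 2 := by
    nlinarith
  exact le_of_mul_le_mul_left h5 (by positivity)

/-- The failed test bounds the energy change from below, `H_succ_sub_le` from above; what remains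
bounds the inertial term in `‖incr X k‖ ^ 2`. Scaling by `2 * (h k * a k) * (μ k)⁻¹` gives a
quadratic inequality that remains valid for `a k = 0`. -/
theorem sq_scaled_incr_le (S : Setup f ft lam v Lf μbar κ Lt s ε α a b h X μ) {k : ℕ}
    (hk : k ∈ Ns μ) :
    (h k * a k * (μ k)⁻¹ * ‖incr X k‖) ^ 2 ≤
      2 * (h k * a k) * ((α + α / ε) * μ k + 2 * Lf * (‖incr X (k + 1)‖ * (μ k)⁻¹)) +
      2 * (h k * a k) * (‖incr X (k + 1)‖ * (μ k)⁻¹) * (h k * a k * (μ k)⁻¹ * ‖incr X k‖) := by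
  have h1 := S.neg_lt_of_mem_Ns hk
  have h2 := S.H_succ_sub_le k
  have h3 := S.mul_norm_incr_succ_sq_lt hk
  have h4 := S.penalty_sub_le k
  have h5 := S.ft_sub_le k (X k) (X (k + 1))
  change _ ≤ Lf * ‖incr X (k + 1)‖ at h5
  set D := incr X (k + 1)
  set E := incr X k
  set G := grad (fun W => ft W (μ k)) (extrap X (b k) k)
  have hG : -⟪D, G⟫_ℝ ≤ Lf * ‖D‖ := by
    have := (abs_le.1 (abs_real_inner_le_norm D G)).1
    have := S.norm_grad_ft_le k (extrap X (b k) k)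
    nlinarith [norm_nonneg D]
  have hDE := real_inner_le_norm D E
  have hμ := S.mu_pos k
  have hp := inv_pos.2 hμ
  have hh := S.param.h_pos k
  have ha := S.param.a_nonneg k
  have hε := S.param.ε_pos
  have hα := S.run.α_pos
  have hha : 0 ≤ h k * a k * (μ k)⁻¹ := by positivity
  have h6 := mul_le_mul_of_nonneg_left hDE hha
  have h7 : 0 ≤ h k * (μ k)⁻¹ / 2 * ‖D‖ ^ 2 := by positivity
  have h8 : h k * a k / 2 * (μ (k + 1))⁻¹ * ‖D‖ ^ 2 ≤ α / ε * μ k ^ 2 := by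
    have e : h k * a k / 2 * (μ (k + 1))⁻¹ * ‖D‖ ^ 2 =
        a k / ε * (h k * ε / 2 * (μ (k + 1))⁻¹ * ‖D‖ ^ 2) := by field_simp
    have e2 : α / ε * μ k ^ 2 = 1 / ε * (α * μ k ^ 2) := by ring
    rw [e, e2]
    have := S.a_lt_half k
    have : a k / ε ≤ 1 / ε := by gcongr; linarith
    exact mul_le_mul this h3.le (by have := S.mu_pos (k + 1); positivity) (by positivity)
  have h9 : h k * a k / 2 * (μ k)⁻¹ * ‖E‖ ^ 2 ≤
      (α + α / ε) * μ k ^ 2 + 2 * Lf * ‖D‖ + h k * a k * (μ k)⁻¹ * (‖D‖ * ‖E‖) := by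
    linarith
  have h10 := mul_le_mul_of_nonneg_left h9 (by positivity : 0 ≤ 2 * (h k * a k) * (μ k)⁻¹)
  have e3 : (μ k)⁻¹ * μ k = 1 := inv_mul_cancel₀ hμ.ne'
  calc (h k * a k * (μ k)⁻¹ * ‖E‖) ^ 2
      = 2 * (h k * a k) * (μ k)⁻¹ * (h k * a k / 2 * (μ k)⁻¹ * ‖E‖ ^ 2) := by ring
    _ ≤ _ := h10
    _ = 2 * (h k * a k) * ((α + α / ε) * (((μ k)⁻¹ * μ k) * μ k) + 2 * Lf * (‖D‖ * (μ k)⁻¹)) +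
      2 * (h k * a k) * (‖D‖ * (μ k)⁻¹) * (h k * a k * (μ k)⁻¹ * ‖E‖) := by ring
    _ = _ := by rw [e3, one_mul]

theorem eventually_mul_norm_incr_le (S : Setup f ft lam v Lf μbar κ Lt s ε α a b h X μ)
    (hN : (Ns μ).Infinite) {δ : ℝ} (hδ : 0 < δ) :
    ∀ᶠ k in atTop, k ∈ Ns μ → h k * a k * ‖incr X k‖ ≤ δ * μ k := by
  have hε := S.param.ε_pos
  have hα := S.run.α_pos
  have hLf := S.prob.Lf_pos
  have hh0 := S.param.h_pos 0
  set c₁ := 2 * h 0 * (α + α / ε + 2 * Lf) with hc₁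
  have hc₁0 : 0 < c₁ := by positivity
  obtain ⟨η, hη, hη1, hη2⟩ : ∃ η : ℝ, 0 < η ∧ c₁ * η ≤ δ ^ 2 / 2 ∧ 2 * h 0 * η ≤ δ / 2 := by
    refine ⟨min (δ ^ 2 / 2 / c₁) (δ / 2 / (2 * h 0)), by positivity, ?_, ?_⟩
    · rw [mul_comm, ← le_div_iff₀ hc₁0]
      exact min_le_left _ _
    · rw [mul_comm, ← le_div_iff₀ (by positivity)]
      exact min_le_right _ _
  filter_upwards [(S.tendsto_mu hN).eventually (gt_mem_nhds hη),
    S.eventually_norm_incr_succ_le hN hη] with k hk1 hk2 hkN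
  have h1 := S.sq_scaled_incr_le hkN
  have hμ := S.mu_pos k
  have hd : ‖incr X (k + 1)‖ * (μ k)⁻¹ ≤ η := by
    rw [← div_eq_mul_inv, div_le_iff₀ hμ]
    exact hk2 hkN
  have hd0 : 0 ≤ ‖incr X (k + 1)‖ * (μ k)⁻¹ := by positivity
  have hha0 : 0 ≤ h k * a k := mul_nonneg (S.param.h_pos k).le (S.param.a_nonneg k)
  have hha : h k * a k ≤ h 0 := by
    have := S.param.h_antitone (Nat.zero_le k)
    nlinarith [S.a_lt_half k, S.param.h_pos k]
  set t := h k * a k * (μ k)⁻¹ * ‖incr X k‖ with ht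
  have ht0 : 0 ≤ t := by positivity
  have htδ : t ≤ δ := by
    -- If `t > δ`, the choice of `η` gives `t ^ 2 ≤ δ ^ 2 / 2 + δ / 2 * t < t ^ 2`.
    by_contra hlt
    push Not at hlt
    have h2 : 2 * (h k * a k) * ((α + α / ε) * μ k + 2 * Lf * (‖incr X (k + 1)‖ * (μ k)⁻¹)) ≤
        δ ^ 2 / 2 := by
      refine le_trans ?_ hη1
      calc _ ≤ 2 * h 0 * ((α + α / ε) * η + 2 * Lf * η) := by gcongr
        _ = c₁ * η := by rw [hc₁]; ring
    have h3 : 2 * (h k * a k) * (‖incr X (k + 1)‖ * (μ k)⁻¹) ≤ δ / 2 := by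
      refine le_trans ?_ hη2
      gcongr
    have h4 := mul_le_mul_of_nonneg_right h3 ht0
    nlinarith
  rw [ht, mul_right_comm, ← div_eq_mul_inv, div_le_iff₀ hμ] at htδ
  exact htδ

end Reduction

/-! ### The subproblem as soft thresholding. -/

section Subproblem

/-- The singular values below the threshold `v` are replaced by soft thresholded ones. -/
theorem svN_succ_eq (S : Setup f ft lam v Lf μbar κ Lt s ε α a b h X μ) {k i : ℕ}
    (hi : svN (X k) i < v) :
    svN (X (k + 1)) i = max (svN (extrap X (a k) k - (μ k / h k) •
      grad (fun W => ft W (μ k)) (extrap X (b k) k)) i - lam / v * (μ k / h k)) 0 := by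
  set Y := extrap X (a k) k with hY
  set G := grad (fun W => ft W (μ k)) (extrap X (b k) k) with hG
  have hv := S.prob.v_pos
  have hμ := S.mu_pos k
  have hh := S.param.h_pos k
  have hlam := S.prob.lam_pos
  set τ := lam / v * (μ k / h k) with hτ
  have hτ0 : 0 ≤ τ := by positivity
  set t : ℕ → ℝ := fun i => if svN (X k) i < v then τ else 0 with ht
  -- Completing the square turns the scaled subproblem into a weighted proximal problem, up to a
  -- constant. The weights are `τ` where `svN (X k) i < v` and zero elsewhere, hence nondecreasing
  -- in `i`.
  have hQ : ∀ X' : Mat m n, 1 / 2 * ‖X' - (Y - (μ k / h k) • G)‖ ^ 2 + ∑ i : Fin n, t i * svN X' i =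
      μ k / h k * Q ft lam v (h k) (dvec v (X k)) Y (extrap X (b k) k) (μ k) X' +
      (1 / 2 * (μ k / h k) ^ 2 * ‖G‖ ^ 2 -
        ∑ i : Fin n, μ k / h k * (lam * if svN (X k) i < v then 0 else 1)) := by
    intro X'
    have e1 : X' - (Y - (μ k / h k) • G) = (X' - Y) + (μ k / h k) • G := by abel
    have e2 : μ k / h k * (lam * PhiD v (dvec v (X k)) X') = ∑ i : Fin n, t i * svN X' i +
        ∑ i : Fin n, μ k / h k * (lam * if svN (X k) i < v then 0 else 1) := by
      rw [← Finset.sum_add_distrib, PhiD, Finset.mul_sum, Finset.mul_sum]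
      refine Finset.sum_congr rfl fun i _ => ?_
      simp only [dvec, theta, sv_eq_svN, ht, hτ]
      by_cases h1 : svN (X k) i < v
      · simp only [h1, if_true]
        ring
      · simp only [h1, if_false, OfNat.ofNat_ne_one]
        ring
    rw [e1, norm_add_sq_real, inner_smul_right, norm_smul, Real.norm_of_nonneg (by positivity)]
    simp only [Q, ← inner_eq_ip, ← hG]
    have e3 : μ k / h k * (1 / 2 * (h k * (μ k)⁻¹) * ‖X' - Y‖ ^ 2) = 1 / 2 * ‖X' - Y‖ ^ 2 := by
      field_simp
    rw [mul_add (μ k / h k), mul_add (μ k / h k), e2, e3]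
    ring
  have hmono : Monotone t := by
    intro i j hij
    simp only [ht]
    split_ifs with h1 h2
    · exact le_rfl
    · exact absurd ((svN_antitone _ hij).trans_lt h1) h2
    · exact hτ0
    · exact le_rfl
  have := svN_of_isMin_prox (X := X (k + 1)) (W := Y - (μ k / h k) • G) hmono
    (fun i => by simp only [ht]; split_ifs; exacts [hτ0, le_rfl])
    (fun X' => by
      rw [hQ, hQ]
      have h1 := isMinOn_univ_iff.1 (S.run.step k) X'
      gcongr) i
  rw [this]
  simp only [ht, if_pos hi]

/-- Thresholding shortens the tail by `lam / v * (μ k / h k)`, the gradient step lengthens it by at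
most `Lf * (μ k / h k)`, and Eckart–Young compares the tail before both with the distance to `P`. -/
theorem sqrt_tailSq_add_le (S : Setup f ft lam v Lf μbar κ Lt s ε α a b h X μ) {k r : ℕ}
    (hr : svN (X k) r < v) (hr' : svN (X (k + 1)) r ≠ 0) {P : Mat m n} (hP : svN P r = 0) :
    √(tailSq r (X (k + 1))) + (lam / v - Lf) * (μ k / h k) ≤ ‖extrap X (a k) k - P‖ := by
  set G := grad (fun W => ft W (μ k)) (extrap X (b k) k) with hG
  have hd : 0 < μ k / h k := div_pos (S.mu_pos k) (S.param.h_pos k)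
  have hτ0 : 0 ≤ lam / v * (μ k / h k) :=
    mul_nonneg (div_nonneg S.prob.lam_pos.le S.prob.v_pos.le) hd.le
  have h1 := sq_sqrt_tailSq_add_le hτ0
    (fun i hi => S.svN_succ_eq ((svN_antitone (X k) hi).trans_lt hr)) hr'
  have h2 := abs_le_of_sq_le_sq' (h1.trans (tailSq_le_norm_sub_sq r _ P hP)) (norm_nonneg _) |>.2
  have h3 : ‖extrap X (a k) k - (μ k / h k) • G - P‖ ≤
      ‖extrap X (a k) k - P‖ + μ k / h k * Lf := by
    rw [sub_right_comm]
    refine (norm_sub_le _ _).trans ?_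
    rw [norm_smul, Real.norm_of_nonneg hd.le]
    have := S.norm_grad_ft_le k (extrap X (b k) k)
    gcongr
  linarith

/-- A surviving singular value has dropped by exactly the threshold, and Mirsky bounds this drop by
the distance between the gradient-step point and `X (k + 1)`. -/
theorem slope_mul_mu_le (S : Setup f ft lam v Lf μbar κ Lt s ε α a b h X μ) {k r : ℕ}
    (hr : svN (X k) r < v) (hr' : svN (X (k + 1)) r ≠ 0) :
    (lam / v - Lf) * μ k ≤ h k * ‖incr X (k + 1)‖ + h k * a k * ‖incr X k‖ := by
  set G := grad (fun W => ft W (μ k)) (extrap X (b k) k) with hG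
  set W := extrap X (a k) k - (μ k / h k) • G with hW
  have hh := S.param.h_pos k
  have hd : 0 < μ k / h k := div_pos (S.mu_pos k) hh
  have h1 := S.svN_succ_eq hr
  have h2 : svN W r - svN (X (k + 1)) r = lam / v * (μ k / h k) := by
    rcases max_choice (svN W r - lam / v * (μ k / h k)) 0 with h3 | h3
    · rw [h1, h3]
      ring
    · exact absurd (h1.trans h3) hr'
  have h3 := (le_abs_self _).trans (abs_svN_sub_le W (X (k + 1)) r)
  rw [h2] at h3
  have e : W - X (k + 1) = a k • incr X k - incr X (k + 1) - (μ k / h k) • G := by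
    simp only [hW, extrap, incr, Nat.add_sub_cancel]
    abel
  have h4 : ‖W - X (k + 1)‖ ≤ a k * ‖incr X k‖ + ‖incr X (k + 1)‖ + μ k / h k * Lf := by
    rw [e]
    refine (norm_sub_le _ _).trans (add_le_add ((norm_sub_le _ _).trans ?_) ?_)
    · rw [norm_smul, Real.norm_of_nonneg (S.param.a_nonneg k)]
    · rw [norm_smul, Real.norm_of_nonneg hd.le]
      have := S.norm_grad_ft_le k (extrap X (b k) k)
      gcongr
  have h5 : (lam / v - Lf) * (μ k / h k) ≤ a k * ‖incr X k‖ + ‖incr X (k + 1)‖ := by linarith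
  rw [← mul_div_assoc, div_le_iff₀ hh] at h5
  linarith

theorem eventually_svN_succ_eq_zero (S : Setup f ft lam v Lf μbar κ Lt s ε α a b h X μ)
    (hN : (Ns μ).Infinite) :
    ∀ᶠ k in atTop, k ∈ Ns μ → ∀ r, svN (X k) r < v → svN (X (k + 1)) r = 0 := by
  have hc := S.slope_pos
  have hh0 := S.param.h_pos 0
  filter_upwards [S.eventually_norm_incr_succ_le hN
    (by positivity : 0 < (lam / v - Lf) / (4 * h 0)),
    S.eventually_mul_norm_incr_le hN (by positivity : 0 < (lam / v - Lf) / 4)]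
    with k hk1 hk2 hkN r hr
  by_contra hne
  have h1 := S.slope_mul_mu_le hr hne
  have h2 := hk2 hkN
  have hμ := S.mu_pos k
  have h3 : h k * ‖incr X (k + 1)‖ ≤ h 0 * ((lam / v - Lf) / (4 * h 0) * μ k) :=
    mul_le_mul (S.param.h_antitone (Nat.zero_le k)) (hk1 hkN) (norm_nonneg _) hh0.le
  have h4 : h 0 * ((lam / v - Lf) / (4 * h 0) * μ k) = (lam / v - Lf) / 4 * μ k := by
    field_simp
  nlinarith [mul_pos hc hμ]

end Subproblem

end Setup

/-! ### Dead indices. -/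

/-- A condition at step `k` that keeps the singular value with index `r` below `v` from then on. -/
def Dead {m n : ℕ} (v : ℝ) (X : ℕ → Mat m n) (r k : ℕ) : Prop :=
  tailSq r (X k) + max (tailSq r (X k) - tailSq r (X (k - 1))) 0 < v ^ 2

namespace Dead

variable {m n : ℕ} {v : ℝ} {X : ℕ → Mat m n} {r k : ℕ}

theorem svN_lt (hv : 0 < v) (hd : Dead v X r k) : svN (X k) r < v := by
  refine lt_of_pow_lt_pow_left₀ 2 hv.le ((svN_sq_le_tailSq r (X k)).trans_lt ?_)
  exact lt_of_le_of_lt (le_add_of_nonneg_right (le_max_right _ _)) hd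

theorem of_svN_eq_zero (hv : 0 < v) (h0 : svN (X k) r = 0) : Dead v X r k := by
  rw [Dead, tailSq_eq_zero h0, zero_sub, max_eq_right (neg_nonpos.2 (tailSq_nonneg _ _)), add_zero]
  positivity

/-- The earlier tail is at least `v ^ 2` and the present one is below it, so the positive part
vanishes. -/
theorem of_crossing (h0 : svN (X k) (r + 1) = 0) (h1 : svN (X k) r < v)
    (h2 : v ≤ svN (X (k - 1)) r) (hv : 0 < v) : Dead v X r k := by
  have h3 := tailSq_le_svN_sq h0
  have h4 := svN_sq_le_tailSq r (X (k - 1))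
  have h5 : svN (X k) r ^ 2 < v ^ 2 := pow_lt_pow_left₀ h1 (svN_nonneg _ _) two_ne_zero
  have h6 : v ^ 2 ≤ svN (X (k - 1)) r ^ 2 := pow_le_pow_left₀ hv.le h2 2
  rw [Dead, max_eq_right (by linarith)]
  linarith

end Dead

namespace Setup

variable {m n : ℕ} {f : Mat m n → ℝ} {ft : Mat m n → ℝ → ℝ}
  {lam v Lf μbar κ Lt s ε α : ℝ} {a b h : ℕ → ℝ} {X : ℕ → Mat m n} {μ : ℕ → ℝ}

/-! ### Persistence of dead indices and of low rank. -/

section Persistence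

/-- Let `T` be the squared tail at `k` and `M` the positive part of its last increase. Inertia
raises the squared tail by at most `a k * M` plus `‖incr X k‖ ^ 2`, and thresholding pays for the
latter. The quantity in `Dead` is then at most `T + 2 * a k * M`, hence below `v ^ 2` because `a k <
1 / 2`. -/
theorem dead_succ (S : Setup f ft lam v Lf μbar κ Lt s ε α a b h X μ) {r k : ℕ}
    (hd : Dead v X r k) (hE : ‖incr X k‖ ^ 2 ≤ v * (lam / v - Lf) / (2 * h 0) * μ k) :
    Dead v X r (k + 1) := by
  have hv := S.prob.v_pos
  by_cases h0 : svN (X (k + 1)) r = 0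
  · exact Dead.of_svN_eq_zero hv h0
  obtain ⟨P, hP, hXP⟩ := exists_norm_sub_sq_le_tailSq r (X k)
  have h1 := S.sqrt_tailSq_add_le (hd.svN_lt hv) h0 hP
  have hXP' := tailSq_le_norm_sub_sq r (X (k - 1)) P hP
  have ha0 := S.param.a_nonneg k
  have ha1 := S.a_lt_half k
  have hc := S.slope_pos
  have hh := S.param.h_pos k
  have hμ := S.mu_pos k
  set c := lam / v - Lf with hcdef
  set E := incr X k with hEdef
  have eY : extrap X (a k) k - P = (X k - P) + a k • E := by
    simp only [extrap, hEdef, incr]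
    abel
  have eX : X (k - 1) - P = (X k - P) - E := by
    simp only [hEdef, incr]
    abel
  have h2 : ‖extrap X (a k) k - P‖ ^ 2 ≤ tailSq r (X k) +
      a k * (tailSq r (X k) - tailSq r (X (k - 1))) + ‖E‖ ^ 2 := by
    rw [eX, norm_sub_sq_real] at hXP'
    rw [eY, norm_add_sq_real, inner_smul_right, norm_smul, Real.norm_of_nonneg ha0]
    have h3 := mul_le_mul_of_nonneg_left hXP' ha0
    have h4 := mul_le_mul_of_nonneg_left hXP (by linarith : 0 ≤ 1 + a k)
    have h5 : (a k ^ 2 + a k) * ‖E‖ ^ 2 ≤ 1 * ‖E‖ ^ 2 :=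
      mul_le_mul_of_nonneg_right (by nlinarith) (sq_nonneg _)
    nlinarith
  set q := √(tailSq r (X (k + 1))) with hq
  have hq0 : 0 ≤ q := Real.sqrt_nonneg _
  have hqsq : q ^ 2 = tailSq r (X (k + 1)) := Real.sq_sqrt (tailSq_nonneg _ _)
  have hd' := hd
  rw [Dead] at hd' ⊢
  rw [Nat.add_sub_cancel, ← hqsq]
  have hN0 := tailSq_nonneg r (X k)
  -- Thresholding pays `2 * q * (c * (μ k / h k))`, which covers `‖E‖ ^ 2` once `q ≥ v / 4`; for
  -- smaller `q` the tail is far below `v` anyway.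
  by_cases hsmall : q < v / 4
  · have h3 : q ^ 2 < (v / 4) ^ 2 := pow_lt_pow_left₀ hsmall hq0 two_ne_zero
    have h4 : max (q ^ 2 - tailSq r (X k)) 0 ≤ q ^ 2 := max_le (by linarith) (sq_nonneg q)
    nlinarith
  · push Not at hsmall
    have hd0 : 0 ≤ c * (μ k / h k) := by positivity
    have h3 : (q + c * (μ k / h k)) ^ 2 ≤ ‖extrap X (a k) k - P‖ ^ 2 :=
      pow_le_pow_left₀ (by positivity) h1 2
    have h4 : ‖E‖ ^ 2 ≤ 2 * q * (c * (μ k / h k)) := by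
      refine hE.trans ?_
      calc v * c / (2 * h 0) * μ k = 2 * (v / 4) * (c * (μ k / h 0)) := by
            have := S.param.h_pos 0
            field_simp
            ring
        _ ≤ _ := by
            have := S.param.h_antitone (Nat.zero_le k)
            have := S.param.h_pos 0
            have : 0 ≤ c * (μ k / h 0) := by positivity
            gcongr
    have h5 : q ^ 2 - tailSq r (X k) ≤ a k * (tailSq r (X k) - tailSq r (X (k - 1))) := by
      nlinarith [sq_nonneg (c * (μ k / h k))]
    set M := max (tailSq r (X k) - tailSq r (X (k - 1))) 0 with hM
    have hM0 : 0 ≤ M := le_max_right _ _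
    have h6 : q ^ 2 - tailSq r (X k) ≤ a k * M :=
      h5.trans (mul_le_mul_of_nonneg_left (le_max_left _ _) ha0)
    have h7 : max (q ^ 2 - tailSq r (X k)) 0 ≤ a k * M := max_le h6 (by positivity)
    nlinarith

theorem dead_of_le (S : Setup f ft lam v Lf μbar κ Lt s ε α a b h X μ) {L r k l : ℕ}
    (hE : ∀ k ≥ L, ‖incr X k‖ ^ 2 ≤ v * (lam / v - Lf) / (2 * h 0) * μ k)
    (hL : L ≤ k) (hkl : k ≤ l) (hd : Dead v X r k) : Dead v X r l := by
  induction l, hkl using Nat.le_induction with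
  | base => exact hd
  | succ l hkl ih => exact S.dead_succ ih (hE l (hL.trans hkl))

/-- The rank stays at most `r` as long as a matrix of rank at most `r` is close to the
extrapolated point. -/
theorem svN_succ_eq_zero_of_extrap (S : Setup f ft lam v Lf μbar κ Lt s ε α a b h X μ) {k r : ℕ}
    (hr : svN (X k) r = 0) {P : Mat m n} (hP : svN P r = 0)
    (hlt : ‖extrap X (a k) k - P‖ < (lam / v - Lf) / h 0 * μ k) : svN (X (k + 1)) r = 0 := by
  by_contra hne
  have h1 := S.sqrt_tailSq_add_le (hr.trans_lt S.prob.v_pos) hne hP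
  have h2 := Real.sqrt_nonneg (tailSq r (X (k + 1)))
  have h3 : (lam / v - Lf) / h 0 * μ k ≤ (lam / v - Lf) * (μ k / h k) := by
    rw [div_mul_eq_mul_div, ← mul_div_assoc]
    have := S.slope_pos
    have := S.mu_pos k
    have := S.param.h_pos k
    have := S.param.h_antitone (Nat.zero_le k)
    gcongr
  linarith

/-- The quadratic extrapolation error is `o(μ k)`, since the leading singular values stay at least
`v`. -/
theorem exists_extrap_sub_lt (S : Setup f ft lam v Lf μbar κ Lt s ε α a b h X μ) {k r : ℕ}
    (hrn : r ≤ n) (hr : svN (X k) r = 0) (hr' : svN (X (k - 1)) r = 0)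
    (hv : ∀ i < r, v ≤ svN (X k) i) (hE : ‖incr X k‖ ≤ v / 2)
    (hE2 : ‖incr X k‖ ^ 2 ≤ (lam / v - Lf) * v / (4 * h 0) * μ k) :
    ∃ P : Mat m n, svN P r = 0 ∧ ‖extrap X (a k) k - P‖ < (lam / v - Lf) / h 0 * μ k := by
  have ha0 := S.param.a_nonneg k
  have ha1 := S.a_lt_half k
  have hv0 := S.prob.v_pos
  have hc := S.slope_pos
  have hh := S.param.h_pos 0
  have hμ := S.mu_pos k
  obtain ⟨P, hP, hle⟩ := exists_rank_le_extrapolation hrn hr hr' hv0 hv hE ha0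
  refine ⟨P, hP, hle.trans_lt ?_⟩
  change a k * (1 + a k) * (2 / v * ‖incr X k‖ ^ 2) < _
  have h1 : a k * (1 + a k) ≤ 1 := by nlinarith
  calc a k * (1 + a k) * (2 / v * ‖incr X k‖ ^ 2)
      ≤ 1 * (2 / v * ((lam / v - Lf) * v / (4 * h 0) * μ k)) := by gcongr
    _ = (lam / v - Lf) / h 0 * μ k / 2 := by
        have hne := hv0.ne'
        rw [one_mul, div_mul_eq_mul_div, div_eq_iff hne]
        ring
    _ < _ := half_lt_self (by positivity)

end Persistence

/-- Far out, the iterates at which the smoothing parameter changes have a fixed number of nonzero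
singular values, all of them at least `v`. -/
theorem exists_index_set (S : Setup f ft lam v Lf μbar κ Lt s ε α a b h X μ) :
    ∃ (A : Set ℕ) (K : ℕ), ∀ k ∈ Ns μ, K ≤ k →
      (∀ r ∈ A, svN (X k) r = 0) ∧ ∀ r ∉ A, v ≤ svN (X k) r := by
  classical
  rcases (Ns μ).finite_or_infinite with hfin | hN
  · obtain ⟨K, hK⟩ := hfin.bddAbove
    exact ⟨∅, K + 1, fun k hk hle => absurd (hK hk) (by omega)⟩
  have hv := S.prob.v_pos
  have hc := S.slope_pos
  have hh := S.param.h_pos 0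
  have hε := S.param.ε_pos
  have hμ0 := S.mu_pos 0
  obtain ⟨L, hL⟩ := eventually_atTop.1 <|
    (S.eventually_norm_incr_sq_le (by positivity : 0 < v * (lam / v - Lf) / (2 * h 0))).and <|
    (S.eventually_norm_incr_sq_le (by positivity : 0 < (lam / v - Lf) * v / (4 * h 0))).and <|
    (S.eventually_norm_incr_sq_le (by positivity : 0 < (v / 2) ^ 2 / μ 0)).and <|
    (S.eventually_svN_succ_eq_zero hN).and
    (S.eventually_norm_incr_succ_le hN (by positivity : 0 < (lam / v - Lf) / h 0 * ε))
  have hE1 := fun k hk => (hL k hk).1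
  have hE2 := fun k hk => (hL k hk).2.1
  have hE3 : ∀ k ≥ L, ‖incr X k‖ ≤ v / 2 := by
    intro k hk
    refine abs_le_of_sq_le_sq' ((hL k hk).2.2.1.trans ?_) (by positivity) |>.2
    rw [div_mul_eq_mul_div, div_le_iff₀ hμ0]
    exact mul_le_mul_of_nonneg_left (S.mu_antitone (Nat.zero_le k)) (sq_nonneg _)
  have hZ := fun k hk => (hL k hk).2.2.2.1
  have hD := fun k hk => (hL k hk).2.2.2.2
  set A : Set ℕ := {r | ∃ k ≥ L, Dead v X r k} with hA
  have hnA : n ∈ A := ⟨L, le_rfl, Dead.of_svN_eq_zero hv (svN_of_le _ le_rfl)⟩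
  -- Minimality of `r₀` protects all smaller indices: falling below `v` in either way treated in
  -- `hge` and `hstay` would make one of them dead.
  obtain ⟨r₀, hr₀A, hr₀⟩ : ∃ r₀ ∈ A, ∀ r ∈ A, r₀ ≤ r :=
    ⟨Nat.find ⟨n, hnA⟩, Nat.find_spec ⟨n, hnA⟩, fun r hr => Nat.find_min' ⟨n, hnA⟩ hr⟩
  obtain ⟨K₁, hK₁L, hK₁⟩ := hr₀A
  have hlt : ∀ l ≥ K₁, svN (X l) r₀ < v := fun l hl =>
    (S.dead_of_le hE1 hK₁L hl hK₁).svN_lt hv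
  have hge : ∀ k ∈ Ns μ, L ≤ k → ∀ r < r₀, v ≤ svN (X k) r := by
    intro k hk hLk r hr
    by_contra hlt'
    push Not at hlt'
    have h1 : r ∈ A :=
      ⟨k + 1, by omega, Dead.of_svN_eq_zero hv (hZ k hLk hk r hlt')⟩
    exact absurd (hr₀ r h1) (not_le.2 hr)
  -- It suffices to treat the last protected index `p = r₀ - 1`; with `svN (X l) r₀ = 0`, crossing
  -- `v` there makes `p` dead.
  have hstay : ∀ l ≥ L, svN (X l) r₀ = 0 → (∀ r < r₀, v ≤ svN (X (l - 1)) r) →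
      ∀ r < r₀, v ≤ svN (X l) r := by
    intro l hl h0 hprev r hr
    obtain ⟨p, rfl⟩ : ∃ p, r₀ = p + 1 := ⟨r₀ - 1, by omega⟩
    refine le_trans ?_ (svN_antitone (X l) (Nat.lt_succ_iff.1 hr))
    by_contra hlt'
    push Not at hlt'
    have h1 : p ∈ A := ⟨l, hl, Dead.of_crossing h0 hlt' (hprev p p.lt_succ_self) hv⟩
    have := hr₀ p h1
    omega
  obtain ⟨k₀, hk₀N, hk₀⟩ := hN.exists_gt K₁
  have hk₀L : L ≤ k₀ := hK₁L.trans hk₀.le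
  have hmain : ∀ l ≥ k₀ + 1, svN (X l) r₀ = 0 ∧ (∀ r < r₀, v ≤ svN (X l) r) ∧
      ∃ P : Mat m n, svN P r₀ = 0 ∧ ‖extrap X (a l) l - P‖ < (lam / v - Lf) / h 0 * μ l := by
    intro l hl
    induction l, hl using Nat.le_induction with
    | base =>
      have h0 := hZ k₀ hk₀L hk₀N r₀ (hlt k₀ hk₀.le)
      -- `X k₀` may have rank above `r₀`, so the extrapolation lemma is unavailable here. Instead
      -- `P` is `X (k₀ + 1)` itself, using the sharper increment bound at `k₀ ∈ Ns μ` and `ε * μ k₀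
      -- ≤ μ (k₀ + 1)`.
      refine ⟨h0, hstay (k₀ + 1) (by omega) h0 (hge k₀ hk₀N hk₀L), X (k₀ + 1), h0, ?_⟩
      have h1 : extrap X (a (k₀ + 1)) (k₀ + 1) - X (k₀ + 1) =
          a (k₀ + 1) • incr X (k₀ + 1) := by
        simp only [extrap, incr]
        abel
      rw [h1, norm_smul, Real.norm_of_nonneg (S.param.a_nonneg _)]
      have hμk := S.mu_pos k₀
      have h3 : a (k₀ + 1) * ‖incr X (k₀ + 1)‖ ≤ 1 / 2 * ((lam / v - Lf) / h 0 * ε * μ k₀) :=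
        mul_le_mul (S.a_lt_half _).le (hD k₀ hk₀L hk₀N) (norm_nonneg _) (by norm_num)
      have h4 : (lam / v - Lf) / h 0 * (ε * μ k₀) ≤ (lam / v - Lf) / h 0 * μ (k₀ + 1) :=
        mul_le_mul_of_nonneg_left (S.mul_mu_le k₀) (by positivity)
      have h5 : 0 < (lam / v - Lf) / h 0 * μ (k₀ + 1) := by
        have := S.mu_pos (k₀ + 1)
        positivity
      linarith
    | succ l hl ih =>
      obtain ⟨h0, hv', P, hP, hPlt⟩ := ih
      have h0' := S.svN_succ_eq_zero_of_extrap h0 hP hPlt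
      have hv'' := hstay (l + 1) (by omega) h0' hv'
      exact ⟨h0', hv'', S.exists_extrap_sub_lt (hr₀ n hnA) h0' h0 hv''
        (hE3 _ (by omega)) (hE2 _ (by omega))⟩
  refine ⟨{r | r₀ ≤ r}, k₀ + 1, fun k hk hle => ⟨fun r hr => ?_, fun r hr => ?_⟩⟩
  · exact le_antisymm ((svN_antitone (X k) hr).trans (hmain k hle).1.le) (svN_nonneg _ _)
  · exact (hmain k hle).2.1 r (not_le.1 hr)

end Setup

end GIMSPG

/-! ### Index patterns and accumulation points. -/

theorem mainTheorem1 {m n : ℕ} (f : GIMSPG.Mat m n → ℝ) (ft : GIMSPG.Mat m n → ℝ → ℝ)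
    (lam v Lf μbar κ Lt s ε α : ℝ) (a b h : ℕ → ℝ)
    (X : ℕ → GIMSPG.Mat m n) (μ : ℕ → ℝ)
    (hprob : GIMSPG.IsProblem f lam v Lf)
    (hsmooth : GIMSPG.IsSmoothing f ft μbar κ Lt)
    (hparam : GIMSPG.IsParam s ε Lt a b h μ)
    (hrun : GIMSPG.IsRun ft lam v μbar κ s α a b h X μ) :
    (∃ K : ℕ,
      (∀ k ∈ GIMSPG.Ns μ, ∀ l ∈ GIMSPG.Ns μ, K ≤ k → K ≤ l →
        GIMSPG.dvec v (X k) = GIMSPG.dvec v (X l)) ∧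
      (∀ k ∈ GIMSPG.Ns μ, K ≤ k →
        ∀ j : Fin n, GIMSPG.sv (X k) j = 0 ∨ v ≤ GIMSPG.sv (X k) j)) ∧
    (∀ Xbar Xstar : GIMSPG.Mat m n,
      GIMSPG.IsAccPoint X (GIMSPG.Ns μ) Xbar → GIMSPG.IsAccPoint X (GIMSPG.Ns μ) Xstar →
        GIMSPG.zeroSet Xbar = GIMSPG.zeroSet Xstar) ∧
    (∀ (Xbar : GIMSPG.Mat m n) (φ : ℕ → ℕ),
      GIMSPG.SubseqTendsto X (GIMSPG.Ns μ) φ Xbar →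
        ∃ J : ℕ, ∀ i ≥ J, ∀ j ∈ GIMSPG.zeroSet Xbar, GIMSPG.sv (X (φ i)) j = 0) := by
  have hv := hprob.v_pos
  obtain ⟨A, K, hAK⟩ := GIMSPG.Setup.exists_index_set ⟨hprob, hsmooth, hparam, hrun⟩
  have hdvec : ∀ k ∈ GIMSPG.Ns μ, K ≤ k → ∀ j : Fin n,
      (GIMSPG.dvec v (X k) j = 1 ↔ (j : ℕ) ∈ A) ∧ (GIMSPG.dvec v (X k) j = 2 ↔ (j : ℕ) ∉ A) := by
    intro k hk hle j
    obtain ⟨h0, h1⟩ := hAK k hk hle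
    by_cases hj : (j : ℕ) ∈ A
    · simp [GIMSPG.dvec, GIMSPG.sv_eq_svN, h0 j hj, hv, hj]
    · simp [GIMSPG.dvec, GIMSPG.sv_eq_svN, not_lt.2 (h1 j hj), hj]
  -- Singular values along the subsequence converge, and eventually each is identically zero or at
  -- least `v`; the gap passes to the limit.
  have hlim : ∀ Xbar φ, GIMSPG.SubseqTendsto X (GIMSPG.Ns μ) φ Xbar →
      GIMSPG.zeroSet Xbar = {j : Fin n | (j : ℕ) ∈ A} := by
    rintro Xbar φ ⟨hφ, hφN, hφX⟩
    have hsv : ∀ j : ℕ, Tendsto (fun i => GIMSPG.svN (X (φ i)) j) atTop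
        (𝓝 (GIMSPG.svN Xbar j)) := by
      intro j
      exact tendsto_iff_norm_sub_tendsto_zero.2 <| squeeze_zero (fun i => norm_nonneg _)
        (fun i => GIMSPG.abs_svN_sub_le _ _ _) (tendsto_iff_norm_sub_tendsto_zero.1 hφX)
    ext j
    simp only [GIMSPG.zeroSet, GIMSPG.sv_eq_svN]
    constructor
    · intro h0
      by_contra hj
      have h1 : v ≤ GIMSPG.svN Xbar j := ge_of_tendsto (hsv j) <| by
        filter_upwards [eventually_ge_atTop K] with i hi
        exact (hAK (φ i) (hφN i) (hi.trans (hφ.le_apply))).2 j hj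
      exact absurd (h1.trans h0.le) (not_le.2 hv)
    · intro hj
      refine tendsto_nhds_unique_of_eventuallyEq (hsv j) tendsto_const_nhds ?_
      filter_upwards [eventually_ge_atTop K] with i hi
      exact (hAK (φ i) (hφN i) (hi.trans (hφ.le_apply))).1 j hj
  refine ⟨⟨K, fun k hk l hl hKk hKl => ?_, fun k hk hKk j => ?_⟩, ?_, ?_⟩
  · funext j
    by_cases hj : (j : ℕ) ∈ A
    · rw [((hdvec k hk hKk j).1).2 hj, ((hdvec l hl hKl j).1).2 hj]
    · rw [((hdvec k hk hKk j).2).2 hj, ((hdvec l hl hKl j).2).2 hj]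
  · by_cases hj : (j : ℕ) ∈ A
    · exact Or.inl ((hAK k hk hKk).1 j hj)
    · exact Or.inr ((hAK k hk hKk).2 j hj)
  · rintro Xbar Xstar ⟨φ, hφ⟩ ⟨ψ, hψ⟩
    rw [hlim Xbar φ hφ, hlim Xstar ψ hψ]
  · intro Xbar φ hφ
    refine ⟨K, fun i hi j hj => ?_⟩
    rw [hlim Xbar φ hφ] at hj
    exact (hAK (φ i) (hφ.2.1 i) (hi.trans hφ.1.le_apply)).1 j hj
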